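/- Let $1<p<\infty$, and let $\varphi\in L^1_{\rm loc}(0,\infty)$ be nonnegative with $\int_0^\infty t^{1/p-1}\varphi(t)\,dt<\infty$. For suitable $f:\mathbb R\to\mathbb C$ put $$H_\varphi f(x)=\int_0^\infty f\left(\frac xt\right)\frac{\varphi(t)}t\,dt,\qquad H(f)(x)=\frac1\pi\,\mathrm{p.v.}\int_{-\infty}^{\infty}\frac{f(y)}{x-y}\,dy .$$ Let $H^p_+(\mathbb R)$, with the $L^p$ norm, be the subspace of all complex-valued $f\in L^p(\mathbb R)$ whose Poisson extension $$x+iy\mapsto \frac1\pi\int_{-\infty}^\infty\frac{y}{(x-s)^2+y^2}f(s)\,ds$$ is holomorphic on the upper half-plane $\{y>0\}$. Then for every $f\in H^p_+(\mathbb R)$ the integral defining $H_\varphi f(x)$ converges absolutely for almost every $x$, $H_\varphi$ is a bounded linear operator from $H^p_+(\mathbb R)$ to $H^p_+(\mathbb R)$, and $$\|H_\varphi\|_{H^p_+(\mathbb R)\to H^p_+(\mathbb R)}=\int_0^\infty t^{1/p-1}\varphi(t)\,dt .$$ Moreover, for every $f\in H^p_+(\mathbb R)$ the principal value $H(f)(x)$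 exists for almost every $x$, $H$ is a bounded linear operator from $H^p_+(\mathbb R)$ to $H^p_+(\mathbb R)$, and $H_\varphi H=HH_\varphi$ on $H^p_+(\mathbb R)$. -/

import Mathlib

open MeasureTheory Set Filter Topology
open scoped ENNReal

noncomputable section

namespace HausdorffHardy

/-- The Hausdorff operator
`H_φ f (x) = ∫₀^∞ f (x / t) φ(t) / t dt`. Only the values of `φ` on `(0, ∞)` matter. -/
def hausdorffOp (φ : ℝ → ℝ) (f : ℝ → ℂ) (x : ℝ) : ℂ :=
  ∫ t in Ioi (0 : ℝ), f (x / t) * ((φ t / t : ℝ) : ℂ)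

/-- The truncated Hilbert transform `(1/π) ∫_{|x - y| > ε} f(y) / (x - y) dy`. -/
def truncatedHilbert (f : ℝ → ℂ) (ε x : ℝ) : ℂ :=
  ((1 / Real.pi : ℝ) : ℂ) * ∫ y in {y : ℝ | ε < |x - y|}, f y / ((x - y : ℝ) : ℂ)

/-- `g` is the Hilbert transform of `f`: for almost every `x` the principal value
`(1/π) p.v. ∫ f(y) / (x - y) dy` exists and equals `g x`. -/
def IsHilbertTransform (f g : ℝ → ℂ) : Prop :=
  ∀ᵐ x : ℝ, Tendsto (fun ε => truncatedHilbert f ε x) (𝓝[>] 0) (𝓝 (g x))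

/-- The Poisson kernel of the upper half-plane,
`P(x + i y, s) = y / (π ((x - s)² + y²))`. -/
def poissonKernelUHP (z : ℂ) (s : ℝ) : ℝ :=
  z.im / (Real.pi * ((z.re - s) ^ 2 + z.im ^ 2))

/-- The Poisson extension of `f` to the upper half-plane. -/
def poissonExt (f : ℝ → ℂ) (z : ℂ) : ℂ :=
  ∫ s : ℝ, (poissonKernelUHP z s : ℂ) * f s

theorem poissonKernelUHP_nonneg {z : ℂ} (hz : 0 < z.im) (s : ℝ) : 0 ≤ poissonKernelUHP z s := by
  unfold poissonKernelUHP; positivity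

theorem poissonKernelUHP_le {z : ℂ} (hz : 0 < z.im) (s : ℝ) :
    poissonKernelUHP z s ≤ 1 / (Real.pi * z.im) := by
  unfold poissonKernelUHP
  have hπ := Real.pi_pos
  rw [div_le_div_iff₀ (by positivity) (by positivity)]
  nlinarith [mul_nonneg hπ.le (sq_nonneg (z.re - s))]

theorem measurable_poissonKernelUHP (z : ℂ) : Measurable (poissonKernelUHP z) := by
  unfold poissonKernelUHP; fun_prop

theorem integrable_poissonKernelUHP {z : ℂ} (hz : 0 < z.im) :
    Integrable (poissonKernelUHP z) := by
  have h := ((integrable_inv_one_add_sq.comp_div hz.ne').comp_sub_left z.re).const_mul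
    (1 / (Real.pi * z.im))
  refine h.congr (Eventually.of_forall fun s => ?_)
  have hπ := Real.pi_pos
  simp only [poissonKernelUHP]
  field_simp
  ring

/-- For `1 ≤ p ≤ ∞` the integral defining the Poisson extension of an `L^p` function converges
absolutely at every point of the upper half-plane. -/
theorem integrable_poissonKernelUHP_mul {p : ℝ≥0∞} (hp : 1 ≤ p) {f : ℝ → ℂ} (hf : MemLp f p)
    {z : ℂ} (hz : 0 < z.im) : Integrable fun s => (poissonKernelUHP z s : ℂ) * f s := by
  set w : ℝ → ℝ≥0∞ := fun s => ENNReal.ofReal (poissonKernelUHP z s) with hw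
  have hwm : Measurable w := (measurable_poissonKernelUHP z).ennreal_ofReal
  have hfin : IsFiniteMeasure (volume.withDensity w) := by
    refine isFiniteMeasure_withDensity ?_
    exact (integrable_poissonKernelUHP hz).lintegral_lt_top.ne
  have hle : volume.withDensity w ≤ ENNReal.ofReal (1 / (Real.pi * z.im)) • volume := by
    rw [← withDensity_const]
    exact withDensity_mono (Eventually.of_forall fun s =>
      ENNReal.ofReal_le_ofReal (poissonKernelUHP_le hz s))
  have h1 : Integrable f (volume.withDensity w) :=
    (hf.of_measure_le_smul ENNReal.ofReal_ne_top hle).integrable hp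
  rw [integrable_withDensity_iff_integrable_smul' hwm
    (Eventually.of_forall fun s => ENNReal.ofReal_lt_top)] at h1
  refine h1.congr (Eventually.of_forall fun s => ?_)
  simp [hw, ENNReal.toReal_ofReal (poissonKernelUHP_nonneg hz s)]

/-- The Hardy space `H^p_+(ℝ)`: the subspace of (complex-valued) `L^p(ℝ)` of those functions whose
Poisson extension to the upper half-plane is holomorphic. It carries the `L^p` norm. -/
def HardyPlus (p : ℝ≥0∞) [Fact (1 ≤ p)] : Submodule ℂ (Lp ℂ p (volume : Measure ℝ)) where
  carrier := {f | DifferentiableOn ℂ (poissonExt f) {z : ℂ | 0 < z.im}}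
  zero_mem' := by
    have h : poissonExt (0 : Lp ℂ p (volume : Measure ℝ)) = fun _ => 0 := by
      funext z
      refine integral_eq_zero_of_ae ?_
      filter_upwards [Lp.coeFn_zero ℂ p (volume : Measure ℝ)] with s hs
      rw [hs]
      simp
    change DifferentiableOn ℂ (poissonExt (0 : Lp ℂ p (volume : Measure ℝ))) {z : ℂ | 0 < z.im}
    rw [h]
    exact differentiableOn_const 0
  add_mem' := by
    intro f g hf hg
    refine (hf.add hg).congr fun z hz => ?_
    have hp : 1 ≤ p := Fact.out
    simp only [poissonExt, Pi.add_apply]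
    rw [← integral_add (integrable_poissonKernelUHP_mul hp (Lp.memLp f) hz)
      (integrable_poissonKernelUHP_mul hp (Lp.memLp g) hz)]
    refine integral_congr_ae ?_
    filter_upwards [Lp.coeFn_add f g] with s hs
    change (poissonKernelUHP z s : ℂ) * (f + g : Lp ℂ p (volume : Measure ℝ)) s = _
    rw [hs, Pi.add_apply, mul_add]
  smul_mem' := by
    intro c f hf
    refine (hf.const_smul c).congr fun z hz => ?_
    simp only [poissonExt, Pi.smul_apply]
    rw [← integral_smul]
    refine integral_congr_ae ?_
    filter_upwards [Lp.coeFn_smul c f] with s hs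
    change (poissonKernelUHP z s : ℂ) * (c • f : Lp ℂ p (volume : Measure ℝ)) s =
      c • ((poissonKernelUHP z s : ℂ) * f s)
    rw [hs, Pi.smul_apply, smul_eq_mul, smul_eq_mul, mul_left_comm]

end HausdorffHardy

end

noncomputable section

namespace HausdorffHardy

/-! Write `D_t f(x) = t^(-1/p) f(x/t)`, an isometry of `L^p`. Then `H_φ f = ∫ D_t f dν(t)` with `dν
= t^(1/p-1) φ(t) dt` on the half-line, a finite measure whose mass is the claimed norm. Everything
about `H_φ` is proved for averages of dilations over a finite measure `ν` on `(0, ∞)`.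

Membership in the Hardy space is turned into the vanishing of the Cauchy transform on the lower
half-plane (`mem_hardyPlus_iff`). This condition is invariant under dilations and, by Fubini, under
their averages.

The upper bound for the norm is Jensen's inequality followed by Tonelli. For the lower bound,
`f_a(x) = (x+i)^(-a)` with `a ↓ 1/p` is asymptotically dilation invariant: `‖f_a‖` blows up, whereas
`D_t f_a - f_a` is a vanishing multiple of `D_t f_a` plus a term bounded uniformly in `a`
(`eLpNorm_dilation_shiftedPower_sub_le`). Hence `H_φ f_a` is nearly `ν(ℝ) f_a`.

On the Hardy space the Hilbert transform is multiplication by `-i` (`isHilbertTransform_neg_I_mul`),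
so it commutes with every linear operator. Since the Cauchy transform vanishes at `x - iε`, the
truncated kernel may be replaced by its difference with `1/(u - iε)`; that difference is dominated
by a Poisson kernel, and convergence follows at Lebesgue points. -/

/-! ### Integrability of `L^p` functions against Cauchy kernels -/

theorem one_lt_toReal {p : ℝ≥0∞} (hp₁ : 1 < p) (hp₂ : p < ∞) : 1 < p.toReal := by
  rw [← ENNReal.toReal_one]
  exact (ENNReal.toReal_lt_toReal (by simp) hp₂.ne).2 hp₁

theorem memLp_inv_one_add_abs {q : ℝ≥0∞} (hq₁ : 1 < q) (hq₂ : q < ∞) :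
    MemLp (fun s : ℝ => (1 + |s|)⁻¹) q := by
  have hq : 1 < q.toReal := one_lt_toReal hq₁ hq₂
  have hm : AEStronglyMeasurable (fun s : ℝ => (1 + |s|)⁻¹) := by
    apply Measurable.aestronglyMeasurable; fun_prop
  rw [← integrable_norm_rpow_iff hm (by positivity) hq₂.ne]
  have h := integrable_one_add_norm (E := ℝ) (μ := volume) (r := q.toReal) (by simpa using hq)
  refine h.congr (Eventually.of_forall fun s => ?_)
  have : (0 : ℝ) ≤ 1 + |s| := by positivity
  simp only [Real.norm_eq_abs, abs_inv, abs_of_nonneg this, Real.rpow_neg this,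
    Real.inv_rpow this]

/-- An `L^p` function, `1 < p < ∞`, is integrable against `(1 + |s|)⁻¹`. -/
theorem integrable_norm_mul_inv_one_add_abs {p : ℝ≥0∞} (hp₁ : 1 < p) (hp₂ : p < ∞) {f : ℝ → ℂ}
    (hf : MemLp f p) : Integrable fun s => ‖f s‖ * (1 + |s|)⁻¹ := by
  have : ENNReal.HolderConjugate p (ENNReal.conjExponent p) :=
    ENNReal.HolderConjugate.conjExponent hp₁.le
  -- `p < ∞` puts the conjugate exponent above `1`, where `(1 + |s|)⁻¹` has finite norm; `1 < p`
  -- makes it finite.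
  have h₁ : 1 < ENNReal.conjExponent p :=
    (ENNReal.HolderConjugate.lt_top_iff_one_lt p _).1 hp₂
  have h₂ : ENNReal.conjExponent p < ∞ :=
    (ENNReal.HolderConjugate.lt_top_iff_one_lt _ p).2 hp₁
  exact hf.norm.integrable_mul (memLp_inv_one_add_abs h₁ h₂)

/-- A kernel of size `O((1 + |s|)⁻¹)` is integrable against `L^p` functions. -/
theorem integrable_mul_of_norm_le {p : ℝ≥0∞} (hp₁ : 1 < p) (hp₂ : p < ∞) {f : ℝ → ℂ}
    (hf : MemLp f p) {k : ℝ → ℂ} (hk : Measurable k) {C : ℝ}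
    (hC : ∀ s, ‖k s‖ ≤ C * (1 + |s|)⁻¹) : Integrable fun s => f s * k s := by
  refine ((integrable_norm_mul_inv_one_add_abs hp₁ hp₂ hf).const_mul C).mono'
    (hf.1.mul hk.aestronglyMeasurable) (Eventually.of_forall fun s => ?_)
  rw [norm_mul]
  calc ‖f s‖ * ‖k s‖ ≤ ‖f s‖ * (C * (1 + |s|)⁻¹) := by gcongr; exact hC s
    _ = _ := by ring

theorem sub_ne_zero_of_im_ne_zero {w : ℂ} (hw : w.im ≠ 0) (s : ℝ) : (s : ℂ) - w ≠ 0 := by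
  intro h
  apply hw
  have := congrArg Complex.im h
  simpa using this

theorem abs_im_le_norm_ofReal_sub (w : ℂ) (s : ℝ) : |w.im| ≤ ‖(s : ℂ) - w‖ := by
  simpa using Complex.abs_im_le_norm ((s : ℂ) - w)

/-- Add `|s| ≤ |s - w| + |w|` and `1 + |w| ≤ |s - w| (1 + |w|) / |Im w|`. -/
theorem norm_inv_ofReal_sub_le {w : ℂ} (hw : w.im ≠ 0) (s : ℝ) :
    ‖((s : ℂ) - w)⁻¹‖ ≤ (1 + (1 + ‖w‖) / |w.im|) * (1 + |s|)⁻¹ := by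
  have h0 := abs_im_le_norm_ofReal_sub w s
  have hw' : 0 < |w.im| := abs_pos.2 hw
  have hpos : 0 < ‖(s : ℂ) - w‖ := hw'.trans_le h0
  have h1 : |s| ≤ ‖(s : ℂ) - w‖ + ‖w‖ := by
    have := norm_add_le ((s : ℂ) - w) w
    simpa using this
  rw [norm_inv, ← div_eq_mul_inv, inv_le_comm₀ hpos (by positivity), inv_div,
    div_le_iff₀ (by positivity)]
  have h2 : 1 + ‖w‖ ≤ ‖(s : ℂ) - w‖ * ((1 + ‖w‖) / |w.im|) := by
    rw [mul_div_assoc', le_div_iff₀ hw']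
    nlinarith [norm_nonneg w]
  linarith

/-! ### The Cauchy transform and the description of the Hardy space by it -/

/-- The Cauchy transform `w ↦ ∫ f(s) / (s - w) ds`. -/
def cauchyTransform (f : ℝ → ℂ) (w : ℂ) : ℂ := ∫ s : ℝ, f s * ((s : ℂ) - w)⁻¹

theorem measurable_inv_ofReal_sub (w : ℂ) : Measurable fun s : ℝ => ((s : ℂ) - w)⁻¹ := by
  fun_prop

theorem integrable_mul_inv_ofReal_sub {p : ℝ≥0∞} (hp₁ : 1 < p) (hp₂ : p < ∞) {f : ℝ → ℂ}
    (hf : MemLp f p) {w : ℂ} (hw : w.im ≠ 0) :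
    Integrable fun s : ℝ => f s * ((s : ℂ) - w)⁻¹ :=
  integrable_mul_of_norm_le hp₁ hp₂ hf (measurable_inv_ofReal_sub w) (norm_inv_ofReal_sub_le hw)

/-- Differentiation under the integral. For `v` within `|Im w| / 2` of `w` one has `|s - v| ≥ |s -
w| / 2`, so `|s - v|⁻² ≤ 4 |s - w|⁻² ≤ (4 / |Im w|) |s - w|⁻¹`. -/
theorem differentiableAt_cauchyTransform {p : ℝ≥0∞} (hp₁ : 1 < p) (hp₂ : p < ∞) {f : ℝ → ℂ}
    (hf : MemLp f p) {w : ℂ} (hw : w.im ≠ 0) :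
    DifferentiableAt ℂ (cauchyTransform f) w := by
  have hw' : 0 < |w.im| := abs_pos.2 hw
  have hball : ∀ v ∈ Metric.ball w (|w.im| / 2), ∀ s : ℝ, ‖(s : ℂ) - w‖ / 2 ≤ ‖(s : ℂ) - v‖ := by
    intro v hv s
    have h1 : ‖v - w‖ < |w.im| / 2 := by simpa [dist_eq_norm] using hv
    have h2 := abs_im_le_norm_ofReal_sub w s
    have h3 : ‖(s : ℂ) - w‖ ≤ ‖(s : ℂ) - v‖ + ‖v - w‖ := by
      have := norm_add_le ((s : ℂ) - v) (v - w)
      simpa using this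
    linarith
  have hne : ∀ v ∈ Metric.ball w (|w.im| / 2), ∀ s : ℝ, (s : ℂ) - v ≠ 0 := by
    intro v hv s
    have h2 := abs_im_le_norm_ofReal_sub w s
    have := hball v hv s
    exact norm_pos_iff.1 (by linarith)
  refine (hasDerivAt_integral_of_dominated_loc_of_deriv_le (𝕜 := ℂ)
    (F := fun w (s : ℝ) => f s * ((s : ℂ) - w)⁻¹)
    (F' := fun w (s : ℝ) => f s * (((s : ℂ) - w) ^ 2)⁻¹)
    (bound := fun s : ℝ => (4 / |w.im|) * ‖f s * ((s : ℂ) - w)⁻¹‖)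
    (Metric.ball_mem_nhds w (half_pos hw')) ?_ ?_ ?_ ?_ ?_ ?_).2.differentiableAt
  · exact Eventually.of_forall fun v => hf.1.mul (measurable_inv_ofReal_sub v).aestronglyMeasurable
  · exact integrable_mul_inv_ofReal_sub hp₁ hp₂ hf hw
  · refine hf.1.mul (Measurable.aestronglyMeasurable ?_)
    fun_prop
  · refine Eventually.of_forall fun s v hv => ?_
    have h1 := hball v hv s
    have h2 := abs_im_le_norm_ofReal_sub w s
    have h3 : 0 < ‖(s : ℂ) - w‖ := hw'.trans_le h2
    rw [norm_mul, norm_mul, norm_inv, norm_inv, norm_pow, mul_left_comm]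
    gcongr
    have h4 : 0 < ‖(s : ℂ) - v‖ := (half_pos h3).trans_le h1
    rw [← div_eq_mul_inv, div_div, inv_le_comm₀ (by positivity) (by positivity), inv_div]
    calc |w.im| * ‖(s : ℂ) - w‖ / 4 ≤ ‖(s : ℂ) - w‖ * ‖(s : ℂ) - w‖ / 4 := by gcongr
      _ = (‖(s : ℂ) - w‖ / 2) ^ 2 := by ring
      _ ≤ _ := by gcongr
  · exact ((integrable_mul_inv_ofReal_sub hp₁ hp₂ hf hw).norm).const_mul _
  · refine Eventually.of_forall fun s v hv => ?_
    have := ((hasDerivAt_id v).const_sub (s : ℂ)).inv (hne v hv s)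
    simpa using this.const_mul (f s)

/-- Dominated convergence along `-iy`, with the kernel at `-i` as majorant for `y ≥ 1`. This limit
identifies the constant in `differentiableOn_poissonExt_iff`. -/
theorem tendsto_cauchyTransform_atBot {p : ℝ≥0∞} (hp₁ : 1 < p) (hp₂ : p < ∞) {f : ℝ → ℂ}
    (hf : MemLp f p) :
    Tendsto (fun y : ℝ => cauchyTransform f (starRingEnd ℂ (y * Complex.I))) atTop (𝓝 0) := by
  have h0 : (0 : ℂ) = ∫ s : ℝ, (0 : ℂ) := by simp
  unfold cauchyTransform
  rw [h0]
  have hI : (starRingEnd ℂ Complex.I).im ≠ 0 := by simp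
  have hn : ∀ y : ℝ, ∀ s : ℝ, ‖(s : ℂ) - starRingEnd ℂ (y * Complex.I)‖ = √(s ^ 2 + y ^ 2) := by
    intro y s
    rw [Complex.norm_def, Complex.normSq_apply]
    simp [sq]
  refine tendsto_integral_filter_of_dominated_convergence
    (fun s : ℝ => ‖f s * ((s : ℂ) - starRingEnd ℂ Complex.I)⁻¹‖) ?_ ?_ ?_ ?_
  · exact Eventually.of_forall fun y =>
      hf.1.mul (measurable_inv_ofReal_sub _).aestronglyMeasurable
  · filter_upwards [eventually_ge_atTop 1] with y hy
    refine Eventually.of_forall fun s => ?_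
    have h1 := hn 1 s
    simp only [Complex.ofReal_one, one_mul] at h1
    rw [norm_mul, norm_mul, norm_inv, norm_inv, hn, h1]
    gcongr
  · exact (integrable_mul_inv_ofReal_sub hp₁ hp₂ hf hI).norm
  · refine Eventually.of_forall fun s => ?_
    rw [tendsto_zero_iff_norm_tendsto_zero]
    have h1 : Tendsto (fun y : ℝ => ‖f s‖ * y⁻¹) atTop (𝓝 0) := by
      simpa using tendsto_inv_atTop_zero.const_mul ‖f s‖
    refine squeeze_zero' (Eventually.of_forall fun _ => norm_nonneg _) ?_ h1
    filter_upwards [eventually_gt_atTop 0] with y hy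
    rw [norm_mul, norm_inv, hn]
    gcongr
    exact Real.le_sqrt_of_sq_le (by nlinarith [sq_nonneg s])

/-- Partial fractions: the Poisson kernel is `(2πi)⁻¹ ((s - z)⁻¹ - (s - z̄)⁻¹)`. -/
theorem poissonExt_eq_cauchyTransform {p : ℝ≥0∞} (hp₁ : 1 < p) (hp₂ : p < ∞) {f : ℝ → ℂ}
    (hf : MemLp f p) {z : ℂ} (hz : 0 < z.im) :
    poissonExt f z = (2 * Real.pi * Complex.I)⁻¹ *
      (cauchyTransform f z - cauchyTransform f (starRingEnd ℂ z)) := by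
  unfold poissonExt cauchyTransform
  have hz' : (starRingEnd ℂ z).im ≠ 0 := by simpa using hz.ne'
  rw [← integral_sub (integrable_mul_inv_ofReal_sub hp₁ hp₂ hf hz.ne')
    (integrable_mul_inv_ofReal_sub hp₁ hp₂ hf hz'), ← integral_const_mul]
  congr 1 with s
  have h1 := sub_ne_zero_of_im_ne_zero hz.ne' s
  have h2 := sub_ne_zero_of_im_ne_zero hz' s
  have hπ : (Real.pi : ℂ) ≠ 0 := by exact_mod_cast Real.pi_ne_zero
  have h3 : ((z.re - s) ^ 2 + z.im ^ 2 : ℂ) = ((s : ℂ) - z) * ((s : ℂ) - starRingEnd ℂ z) := by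
    apply Complex.ext <;> simp [sq] <;> ring
  have h4 : (z.im : ℂ) = (z - starRingEnd ℂ z) / (2 * Complex.I) := by
    rw [Complex.sub_conj]; field_simp
    push_cast; ring
  unfold poissonKernelUHP
  push_cast
  rw [h3]
  nth_rewrite 1 [h4]
  field_simp
  ring

theorem isOpen_upperHalfPlane : IsOpen {z : ℂ | 0 < z.im} :=
  isOpen_lt continuous_const Complex.continuous_im

/-- A function that is both holomorphic and antiholomorphic has zero derivative. -/
theorem deriv_eq_zero_of_differentiableAt_comp_conj {h : ℂ → ℂ} {z : ℂ}
    (h₁ : DifferentiableAt ℂ h (starRingEnd ℂ z))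
    (h₂ : DifferentiableAt ℂ (fun v => h (starRingEnd ℂ v)) z) :
    deriv (fun v => h (starRingEnd ℂ v)) z = 0 := by
  set a := deriv (fun v => h (starRingEnd ℂ v)) z with ha
  have A : ∀ c : ℂ, HasDerivAt (fun t : ℝ => h (starRingEnd ℂ (z + t * c))) (a * c) 0 := by
    intro c
    have hc : HasDerivAt (fun t : ℝ => z + t * c) c 0 := by
      simpa using ((Complex.ofRealCLM.hasDerivAt (x := 0)).mul_const c).const_add z
    have h3 : HasDerivAt (fun v => h (starRingEnd ℂ v)) a (z + ((0 : ℝ) : ℂ) * c) := by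
      rw [Complex.ofReal_zero, zero_mul, add_zero]
      exact h₂.hasDerivAt
    exact HasDerivAt.comp (h₂ := fun v => h (starRingEnd ℂ v)) (0 : ℝ) h3 hc
  have B : ∀ c : ℂ, HasDerivAt (fun t : ℝ => h (starRingEnd ℂ (z + t * c)))
      (deriv h (starRingEnd ℂ z) * starRingEnd ℂ c) 0 := by
    intro c
    have hc : HasDerivAt (fun t : ℝ => starRingEnd ℂ (z + t * c)) (starRingEnd ℂ c) 0 := by
      simpa using ((Complex.ofRealCLM.hasDerivAt (x := 0)).mul_const
        (starRingEnd ℂ c)).const_add (starRingEnd ℂ z)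
    have h3 : HasDerivAt h (deriv h (starRingEnd ℂ z)) (starRingEnd ℂ (z + ((0 : ℝ) : ℂ) * c)) := by
      simpa using h₁.hasDerivAt
    exact h3.comp (0 : ℝ) hc
  -- With `b = h'(z̄)`, direction `1` gives `a = b` and direction `i` gives `a i = -b i`.
  have e1 := (A 1).unique (B 1)
  have eI := (A Complex.I).unique (B Complex.I)
  simp only [mul_one, map_one] at e1
  rw [← e1, Complex.conj_I] at eI
  have : a * Complex.I * 2 = 0 := by linear_combination eI
  simpa using this

/-- The Poisson extension of an `L^p` function is holomorphic exactly if its Cauchy transform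
vanishes on the lower half-plane. -/
theorem differentiableOn_poissonExt_iff {p : ℝ≥0∞} (hp₁ : 1 < p) (hp₂ : p < ∞) {f : ℝ → ℂ}
    (hf : MemLp f p) :
    DifferentiableOn ℂ (poissonExt f) {z : ℂ | 0 < z.im} ↔
      ∀ z : ℂ, 0 < z.im → cauchyTransform f (starRingEnd ℂ z) = 0 := by
  have hd : DifferentiableOn ℂ (cauchyTransform f) {z : ℂ | 0 < z.im} := fun z hz =>
    (differentiableAt_cauchyTransform hp₁ hp₂ hf (ne_of_gt hz)).differentiableWithinAt
  have hc : (2 * Real.pi * Complex.I : ℂ) ≠ 0 := Complex.two_pi_I_ne_zero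
  constructor
  · intro h
    -- The conjugated Cauchy transform is holomorphic, as a combination of two holomorphic
    -- functions, yet it is antiholomorphic by construction; hence it is constant.
    have hG : DifferentiableOn ℂ (fun z => cauchyTransform f (starRingEnd ℂ z))
        {z : ℂ | 0 < z.im} := by
      refine (hd.sub (h.const_mul (2 * Real.pi * Complex.I))).congr fun z hz => ?_
      simp only [Pi.sub_apply]
      rw [poissonExt_eq_cauchyTransform hp₁ hp₂ hf hz]
      field_simp
      ring
    have hconst : ∀ z : ℂ, 0 < z.im → ∀ w : ℂ, 0 < w.im →
        cauchyTransform f (starRingEnd ℂ z) = cauchyTransform f (starRingEnd ℂ w) := by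
      intro z hz w hw
      refine isOpen_upperHalfPlane.is_const_of_deriv_eq_zero
        (convex_halfSpace_im_gt 0).isPreconnected hG (fun v hv => ?_) hz hw
      refine deriv_eq_zero_of_differentiableAt_comp_conj
        (differentiableAt_cauchyTransform hp₁ hp₂ hf ?_)
        (hG.differentiableAt (isOpen_upperHalfPlane.mem_nhds hv))
      simpa using ne_of_gt hv
    intro z hz
    refine tendsto_nhds_unique (l := atTop) (f := fun _ : ℝ => cauchyTransform f (starRingEnd ℂ z))
      tendsto_const_nhds ((tendsto_cauchyTransform_atBot hp₁ hp₂ hf).congr' ?_)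
    filter_upwards [eventually_gt_atTop 0] with y hy
    exact hconst _ (by simpa using hy) _ hz
  · intro h
    refine (hd.const_mul (2 * Real.pi * Complex.I)⁻¹).congr fun z hz => ?_
    rw [poissonExt_eq_cauchyTransform hp₁ hp₂ hf hz, h z hz, sub_zero]

theorem cauchyTransform_congr_ae {f g : ℝ → ℂ} (h : f =ᵐ[volume] g) (w : ℂ) :
    cauchyTransform f w = cauchyTransform g w := by
  refine integral_congr_ae ?_
  filter_upwards [h] with s hs
  rw [hs]

theorem mem_hardyPlus_iff {p : ℝ≥0∞} [Fact (1 ≤ p)] (hp₁ : 1 < p) (hp₂ : p < ∞)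
    (f : Lp ℂ p (volume : Measure ℝ)) :
    f ∈ HardyPlus p ↔ ∀ z : ℂ, 0 < z.im → cauchyTransform f (starRingEnd ℂ z) = 0 :=
  differentiableOn_poissonExt_iff hp₁ hp₂ (Lp.memLp f)

/-! ### Poisson averages at Lebesgue points -/

/-- Take the least `k` with `u ≤ 2^k ε`. If `k > 0`, minimality gives `u > 2^(k-1) ε`; the shift by
one costs the factor `4`. -/
theorem exists_dyadic_bound {ε u : ℝ} (hε : 0 < ε) :
    ∃ k : ℕ, u ≤ 2 ^ k * ε ∧ ε / (u ^ 2 + ε ^ 2) ≤ 4 * (1 / 4) ^ k / ε := by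
  have hex : ∃ k : ℕ, u ≤ 2 ^ k * ε := by
    obtain ⟨k, hk⟩ := pow_unbounded_of_one_lt (u / ε) (by norm_num : (1 : ℝ) < 2)
    exact ⟨k, ((div_lt_iff₀ hε).1 hk).le⟩
  refine ⟨Nat.find hex, Nat.find_spec hex, ?_⟩
  rcases hn : Nat.find hex with _ | k
  · rw [div_le_div_iff₀ (by positivity) hε]
    nlinarith [sq_nonneg u, sq_nonneg ε]
  · have h1 : 2 ^ k * ε < u := by
      have := Nat.find_min hex (m := k) (by omega)
      simpa using this
    have h2 : (2 ^ k * ε) ^ 2 ≤ u ^ 2 := by gcongr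
    have h4 : (2 ^ k * ε) ^ 2 = 4 ^ k * ε ^ 2 := by
      rw [mul_pow, ← pow_mul, mul_comm k 2, pow_mul]; norm_num
    calc ε / (u ^ 2 + ε ^ 2) ≤ ε / (4 ^ k * ε ^ 2) := by
          gcongr
          rw [← h4]; nlinarith [sq_nonneg ε]
      _ = 4 * (1 / 4) ^ (k + 1) / ε := by
          rw [one_div, inv_pow, pow_succ]; field_simp; ring

/-- A Poisson average is dominated by a convergent series of averages over dyadic balls. -/
theorem lintegral_mul_poisson_le {g : ℝ → ℝ} (hg₀ : ∀ s, 0 ≤ g s) (hg : LocallyIntegrable g)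
    {x ε M : ℝ} (hε : 0 < ε) (hM : ∀ r, 0 < r → ⨍ y in Metric.closedBall x r, g y ≤ M) :
    ∫⁻ s, ENNReal.ofReal (g s * (ε / ((x - s) ^ 2 + ε ^ 2))) ≤
      ENNReal.ofReal (∑' k : ℕ, 8 * (1 / 2) ^ k * ⨍ y in Metric.closedBall x (2 ^ k * ε), g y) := by
  have hgm : AEMeasurable g := hg.aestronglyMeasurable.aemeasurable
  have hA : ∀ r, 0 ≤ ⨍ y in Metric.closedBall x r, g y := fun r => by
    rw [setAverage_eq]
    have : 0 ≤ ∫ y in Metric.closedBall x r, g y := integral_nonneg hg₀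
    positivity
  have hsum : Summable fun k : ℕ =>
      8 * (1 / 2 : ℝ) ^ k * ⨍ y in Metric.closedBall x (2 ^ k * ε), g y := by
    refine Summable.of_nonneg_of_le (fun k => mul_nonneg (by positivity) (hA _)) (fun k => ?_)
      ((summable_geometric_two.mul_left 8).mul_right M)
    gcongr
    exact hM _ (by positivity)
  rw [ENNReal.ofReal_tsum_of_nonneg (fun k => mul_nonneg (by positivity) (hA _)) hsum]
  calc ∫⁻ s, ENNReal.ofReal (g s * (ε / ((x - s) ^ 2 + ε ^ 2)))
      ≤ ∫⁻ s, ∑' k : ℕ, (Metric.closedBall x (2 ^ k * ε)).indicator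
          (fun s => ENNReal.ofReal (4 * (1 / 4) ^ k / ε * g s)) s := by
        refine lintegral_mono fun s => ?_
        obtain ⟨k, hk1, hk2⟩ := exists_dyadic_bound (u := |x - s|) hε
        rw [sq_abs] at hk2
        refine le_trans ?_ (ENNReal.le_tsum k)
        rw [indicator_of_mem]
        · apply ENNReal.ofReal_le_ofReal
          rw [mul_comm]
          exact mul_le_mul_of_nonneg_right hk2 (hg₀ s)
        · rwa [Metric.mem_closedBall, dist_comm, Real.dist_eq]
    _ = ∑' k : ℕ, ∫⁻ s, (Metric.closedBall x (2 ^ k * ε)).indicator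
          (fun s => ENNReal.ofReal (4 * (1 / 4) ^ k / ε * g s)) s := by
        refine lintegral_tsum fun k => ?_
        exact (hgm.const_mul _).ennreal_ofReal.indicator Metric.isClosed_closedBall.measurableSet
    _ = _ := by
        -- The ball has length `2 · 2^k ε`, which turns `4 · 4^(-k) / ε` into the coefficient `8 ·
        -- 2^(-k)` of the average.
        congr 1 with k
        have hi : IntegrableOn g (Metric.closedBall x (2 ^ k * ε)) :=
          hg.integrableOn_isCompact (isCompact_closedBall _ _)
        rw [lintegral_indicator Metric.isClosed_closedBall.measurableSet,
          ← ofReal_integral_eq_lintegral_ofReal (hi.const_mul _)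
            (Eventually.of_forall fun s => mul_nonneg (by positivity) (hg₀ s)),
          integral_const_mul, setAverage_eq, Measure.real, Real.volume_closedBall,
          ENNReal.toReal_ofReal (by positivity), smul_eq_mul]
        congr 1
        have : (4 : ℝ) ^ k = 2 ^ k * 2 ^ k := by rw [← mul_pow]; norm_num
        rw [one_div, one_div, inv_pow, inv_pow, this]
        field_simp
        ring

/-- Poisson averages about `x` tend to zero if the averages over balls do. -/
theorem tendsto_lintegral_mul_poisson {g : ℝ → ℝ} (hg₀ : ∀ s, 0 ≤ g s) (hg : LocallyIntegrable g)
    {x M : ℝ} (hM : ∀ r, 0 < r → ⨍ y in Metric.closedBall x r, g y ≤ M)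
    (h : Tendsto (fun r => ⨍ y in Metric.closedBall x r, g y) (𝓝[>] 0) (𝓝 0)) :
    Tendsto (fun ε => ∫⁻ s, ENNReal.ofReal (g s * (ε / ((x - s) ^ 2 + ε ^ 2)))) (𝓝[>] 0)
      (𝓝 0) := by
  have hA : ∀ r, 0 ≤ ⨍ y in Metric.closedBall x r, g y := fun r => by
    rw [setAverage_eq]
    have : 0 ≤ ∫ y in Metric.closedBall x r, g y := integral_nonneg hg₀
    positivity
  have key : Tendsto (fun ε => ∑' k : ℕ, 8 * (1 / 2 : ℝ) ^ k *
      ⨍ y in Metric.closedBall x (2 ^ k * ε), g y) (𝓝[>] 0) (𝓝 (∑' _ : ℕ, (0 : ℝ))) := by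
    refine tendsto_tsum_of_dominated_convergence
      ((summable_geometric_two.mul_left 8).mul_right M) (fun k => ?_) ?_
    · have h1 : Tendsto (fun ε : ℝ => 2 ^ k * ε) (𝓝[>] 0) (𝓝[>] 0) := by
        refine tendsto_nhdsWithin_iff.2 ⟨?_, ?_⟩
        · have : Tendsto (fun ε : ℝ => 2 ^ k * ε) (𝓝 0) (𝓝 (2 ^ k * 0)) := tendsto_id.const_mul _
          rw [mul_zero] at this
          exact this.mono_left nhdsWithin_le_nhds
        · filter_upwards [self_mem_nhdsWithin] with ε hε
          have : (0 : ℝ) < ε := hε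
          exact mem_Ioi.2 (by positivity)
      simpa using (h.comp h1).const_mul (8 * (1 / 2 : ℝ) ^ k)
    · filter_upwards [self_mem_nhdsWithin] with ε hε k
      have : (0 : ℝ) < ε := hε
      rw [Real.norm_of_nonneg (mul_nonneg (by positivity) (hA _))]
      gcongr
      exact hM _ (by positivity)
  rw [tsum_zero] at key
  have key' := ENNReal.tendsto_ofReal key
  rw [ENNReal.ofReal_zero] at key'
  refine tendsto_of_tendsto_of_tendsto_of_le_of_le' tendsto_const_nhds key'
    (Eventually.of_forall fun _ => zero_le) ?_
  filter_upwards [self_mem_nhdsWithin] with ε hε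
  exact lintegral_mul_poisson_le hg₀ hg hε hM

/-- At almost every point, the mean oscillation of an `L^p` function over all centred balls is
bounded, and tends to zero with the radius. -/
theorem ae_average_norm_sub {p : ℝ≥0∞} (hp₁ : 1 ≤ p) (hp₂ : p < ∞) {f : ℝ → ℂ} (hf : MemLp f p) :
    ∀ᵐ x : ℝ, Tendsto (fun r => ⨍ y in Metric.closedBall x r, ‖f y - f x‖) (𝓝[>] 0) (𝓝 0) ∧
      ∃ M, ∀ r, 0 < r → ⨍ y in Metric.closedBall x r, ‖f y - f x‖ ≤ M := by
  have hloc : LocallyIntegrable f := hf.locallyIntegrable hp₁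
  have hp : 1 ≤ p.toReal := by
    rw [← ENNReal.toReal_one]; exact (ENNReal.toReal_le_toReal (by simp) hp₂.ne).2 hp₁
  have hpi : Integrable fun y => ‖f y‖ ^ p.toReal := hf.integrable_norm_rpow (by positivity) hp₂.ne
  filter_upwards [IsUnifLocDoublingMeasure.ae_tendsto_average_norm_sub (μ := volume) hloc 1]
    with x hx
  have ht := hx (l := 𝓝[>] (0 : ℝ)) (fun _ => x) id tendsto_id (by
    filter_upwards [self_mem_nhdsWithin] with r hr
    exact Metric.mem_closedBall_self (by simpa using le_of_lt hr))
  simp only [id] at ht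
  refine ⟨ht, ?_⟩
  obtain ⟨δ, hδ, hδ'⟩ : ∃ δ > 0, ∀ r, 0 < r → r < δ →
      ⨍ y in Metric.closedBall x r, ‖f y - f x‖ < 1 := by
    have := ht.eventually (gt_mem_nhds one_pos)
    obtain ⟨δ, hδ, h⟩ := (mem_nhdsGT_iff_exists_Ioo_subset).1 this
    exact ⟨δ, hδ, fun r h1 h2 => h ⟨h1, h2⟩⟩
  -- Radii below `δ` contribute at most `1`. For `r ≥ δ` use `|f| ≤ 1 + |f|^p` and `1/(2r) ≤
  -- 1/(2δ)`.
  refine ⟨1 + ‖f x‖ + (2 * δ)⁻¹ * ∫ y, ‖f y‖ ^ p.toReal, fun r hr => ?_⟩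
  have hI : 0 ≤ ∫ y, ‖f y‖ ^ p.toReal := integral_nonneg fun y => by positivity
  rcases lt_or_ge r δ with h | h
  · have h1 := (hδ' r hr h).le
    have : 0 ≤ (2 * δ)⁻¹ * ∫ y, ‖f y‖ ^ p.toReal := by positivity
    linarith [norm_nonneg (f x)]
  · have hv : volume.real (Metric.closedBall x r) = 2 * r := by
      rw [Measure.real, Real.volume_closedBall, ENNReal.toReal_ofReal (by positivity)]
    have hc : IntegrableOn (fun _ : ℝ => 1 + ‖f x‖) (Metric.closedBall x r) := by
      rw [integrableOn_const_iff]
      right; rw [Real.volume_closedBall]; exact ENNReal.ofReal_lt_top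
    have hb : ∫ y in Metric.closedBall x r, ‖f y - f x‖ ≤
        2 * r * (1 + ‖f x‖) + ∫ y, ‖f y‖ ^ p.toReal := by
      calc ∫ y in Metric.closedBall x r, ‖f y - f x‖
          ≤ ∫ y in Metric.closedBall x r, ((1 + ‖f x‖) + ‖f y‖ ^ p.toReal) := by
            refine integral_mono_of_nonneg (Eventually.of_forall fun y => norm_nonneg _)
              (hc.add hpi.integrableOn) (Eventually.of_forall fun y => ?_)
            have h1 := norm_sub_le (f y) (f x)
            have h2 : ‖f y‖ ≤ 1 + ‖f y‖ ^ p.toReal := by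
              rcases le_total ‖f y‖ 1 with h | h
              · have : 0 ≤ ‖f y‖ ^ p.toReal := by positivity
                linarith
              · have := Real.rpow_le_rpow_of_exponent_le h hp
                rw [Real.rpow_one] at this
                linarith
            simp only
            linarith
        _ = 2 * r * (1 + ‖f x‖) + ∫ y in Metric.closedBall x r, ‖f y‖ ^ p.toReal := by
            rw [integral_add hc hpi.integrableOn, setIntegral_const, hv, smul_eq_mul]
        _ ≤ _ := by
            exact add_le_add_right
              (setIntegral_le_integral hpi (Eventually.of_forall fun y => by positivity)) _
    rw [setAverage_eq, hv, smul_eq_mul]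
    calc (2 * r)⁻¹ * ∫ y in Metric.closedBall x r, ‖f y - f x‖
        ≤ (2 * r)⁻¹ * (2 * r * (1 + ‖f x‖) + ∫ y, ‖f y‖ ^ p.toReal) := by gcongr
      _ = 1 + ‖f x‖ + (2 * r)⁻¹ * ∫ y, ‖f y‖ ^ p.toReal := by field_simp
      _ ≤ _ := by gcongr

/-! ### The Hilbert transform on the Hardy space -/

/-- The difference of the truncated kernel `1 / u` and `1 / (u - iε)`. -/
def hilbertDiffKernel (ε u : ℝ) : ℂ :=
  {u : ℝ | ε < |u|}.indicator (fun u : ℝ => (u : ℂ)⁻¹) u - ((u : ℂ) - ε * Complex.I)⁻¹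

theorem measurableSet_lt_abs (ε : ℝ) : MeasurableSet {u : ℝ | ε < |u|} :=
  measurableSet_lt measurable_const measurable_norm

theorem measurable_hilbertDiffKernel (ε : ℝ) : Measurable (hilbertDiffKernel ε) := by
  refine Measurable.sub (Measurable.indicator ?_ (measurableSet_lt_abs ε)) ?_
  · fun_prop
  · fun_prop

/-- For `|u| > ε` the kernel is `-iε / (u (u - iε))` and `|u - iε| ≤ 2|u|`; otherwise it is `-(u -
iε)⁻¹` and `|u - iε| ≤ 2ε`. -/
theorem norm_hilbertDiffKernel_le {ε : ℝ} (hε : 0 < ε) (u : ℝ) :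
    ‖hilbertDiffKernel ε u‖ ≤ 2 * (ε / (u ^ 2 + ε ^ 2)) := by
  have hn : ‖(u : ℂ) - ε * Complex.I‖ ^ 2 = u ^ 2 + ε ^ 2 := by
    rw [Complex.sq_norm, Complex.normSq_apply]
    simp [sq]
  have hne : (u : ℂ) - ε * Complex.I ≠ 0 :=
    sub_ne_zero_of_im_ne_zero (by simpa using hε.ne') u
  have hpos := norm_pos_iff.2 hne
  unfold hilbertDiffKernel
  rw [← hn]
  set n := ‖(u : ℂ) - ε * Complex.I‖ with hndef
  by_cases h : ε < |u|
  · have hu : (u : ℂ) ≠ 0 := by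
      have : u ≠ 0 := abs_pos.1 (hε.trans h)
      exact_mod_cast this
    have hu' : 0 < |u| := hε.trans h
    rw [indicator_of_mem (by exact h), inv_sub_inv hu hne, norm_div, norm_mul, ← hndef]
    have e : ‖(u : ℂ) - ε * Complex.I - u‖ = ε := by
      rw [sub_sub_cancel_left, norm_neg, norm_mul]; simp [abs_of_pos hε]
    have hle : n ≤ 2 * |u| := by
      refine le_of_sq_le_sq ?_ (by positivity)
      rw [hn, mul_pow, sq_abs]
      nlinarith [sq_abs u, mul_self_lt_mul_self hε.le h]
    rw [e, Complex.norm_real, Real.norm_eq_abs, mul_div_assoc', div_le_div_iff₀ (by positivity)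
      (by positivity)]
    calc ε * n ^ 2 = ε * n * n := by ring
      _ ≤ ε * n * (2 * |u|) := by gcongr
      _ = _ := by ring
  · rw [indicator_of_notMem (by exact h), zero_sub, norm_neg, norm_inv, ← hndef]
    have hle : n ≤ 2 * ε := by
      refine le_of_sq_le_sq ?_ (by positivity)
      rw [hn]
      nlinarith [sq_abs u, abs_nonneg u, not_lt.1 h]
    rw [inv_eq_one_div, mul_div_assoc', div_le_div_iff₀ (by positivity) (by positivity)]
    nlinarith

theorem integrable_poisson {ε : ℝ} (hε : 0 < ε) :
    Integrable fun u : ℝ => ε / (u ^ 2 + ε ^ 2) := by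
  have h := (integrable_inv_one_add_sq.comp_div hε.ne').const_mul ε⁻¹
  refine h.congr (Eventually.of_forall fun s => ?_)
  simp only
  field_simp
  ring

theorem integral_poisson {ε : ℝ} (hε : 0 < ε) :
    ∫ u : ℝ, ε / (u ^ 2 + ε ^ 2) = Real.pi := by
  have : (fun u : ℝ => ε / (u ^ 2 + ε ^ 2)) = fun u => ε⁻¹ * (1 + (u / ε) ^ 2)⁻¹ := by
    funext u
    field_simp
    ring
  rw [this, integral_const_mul, Measure.integral_comp_div (fun u : ℝ => (1 + u ^ 2)⁻¹),
    integral_univ_inv_one_add_sq, abs_of_pos hε, smul_eq_mul]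
  field_simp

theorem integrable_hilbertDiffKernel {ε : ℝ} (hε : 0 < ε) : Integrable (hilbertDiffKernel ε) :=
  ((integrable_poisson hε).const_mul 2).mono' (measurable_hilbertDiffKernel ε).aestronglyMeasurable
    (Eventually.of_forall (norm_hilbertDiffKernel_le hε))

/-- Symmetrizing in `u` removes the odd truncated kernel `1/u` and leaves `-2i` times a Poisson
kernel of integral `π`. -/
theorem integral_hilbertDiffKernel {ε : ℝ} (hε : 0 < ε) :
    ∫ u, hilbertDiffKernel ε u = -(Real.pi * Complex.I) := by
  have hK := integrable_hilbertDiffKernel hε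
  have h1 : ∫ u, hilbertDiffKernel ε (-u) = ∫ u, hilbertDiffKernel ε u :=
    integral_neg_eq_self _ _
  have h2 : ∀ u : ℝ, hilbertDiffKernel ε u + hilbertDiffKernel ε (-u) =
      -(2 * Complex.I) * ((ε / (u ^ 2 + ε ^ 2) : ℝ) : ℂ) := by
    intro u
    have hne : (u : ℂ) - ε * Complex.I ≠ 0 :=
      sub_ne_zero_of_im_ne_zero (by simpa using hε.ne') u
    have hne' : (u : ℂ) + ε * Complex.I ≠ 0 := by
      have := sub_ne_zero_of_im_ne_zero (w := -(ε * Complex.I)) (by simpa using hε.ne') u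
      simpa using this
    have hne'' : (-u : ℂ) - ε * Complex.I ≠ 0 := by
      rw [← neg_ne_zero]; simpa [add_comm] using hne'
    have e1 : ((-u : ℂ) - ε * Complex.I)⁻¹ = -((u : ℂ) + ε * Complex.I)⁻¹ := by
      rw [← inv_neg]; ring_nf
    have e2 : ((u : ℂ) ^ 2 + ε ^ 2) = (u + ε * Complex.I) * (u - ε * Complex.I) := by
      linear_combination (ε : ℂ) ^ 2 * Complex.I_sq
    unfold hilbertDiffKernel
    have e3 : {u : ℝ | ε < |u|}.indicator (fun u : ℝ => (u : ℂ)⁻¹) (-u) =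
        -{u : ℝ | ε < |u|}.indicator (fun u : ℝ => (u : ℂ)⁻¹) u := by
      by_cases h : ε < |u|
      · rw [indicator_of_mem (by simpa using h), indicator_of_mem (by simpa using h)]
        push_cast; rw [inv_neg]
      · rw [indicator_of_notMem (by simpa using h), indicator_of_notMem (by simpa using h), neg_zero]
    rw [e3]
    push_cast
    rw [e1, e2]
    field_simp
    ring
  have h3 : ∫ u, (hilbertDiffKernel ε u + hilbertDiffKernel ε (-u)) =
      -(2 * Complex.I) * Real.pi := by
    simp_rw [h2]
    rw [integral_const_mul, integral_complex_ofReal, integral_poisson hε]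
  rw [integral_add hK hK.comp_neg, h1] at h3
  linear_combination h3 / 2

/-- Subtracting `1/(u - iε)` from the truncated kernel changes nothing, as the Cauchy transform
vanishes at `x - iε`. The new kernel has integral `-πi`, which accounts for the term in `f x`. -/
theorem truncatedHilbert_add_eq {p : ℝ≥0∞} (hp₁ : 1 < p) (hp₂ : p < ∞) {f : ℝ → ℂ}
    (hf : MemLp f p) (hC : ∀ z : ℂ, 0 < z.im → cauchyTransform f (starRingEnd ℂ z) = 0)
    {ε : ℝ} (hε : 0 < ε) (x : ℝ) :
    truncatedHilbert f ε x - -Complex.I * f x =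
      ((1 / Real.pi : ℝ) : ℂ) * ∫ s, (f s - f x) * hilbertDiffKernel ε (x - s) := by
  have hπ : (Real.pi : ℂ) ≠ 0 := by exact_mod_cast Real.pi_ne_zero
  have hz : (starRingEnd ℂ (x + ε * Complex.I : ℂ)).im ≠ 0 := by simpa using hε.ne'
  have hz' : 0 < (x + ε * Complex.I : ℂ).im := by simpa using hε
  have i1 : Integrable fun s : ℝ =>
      f s * {y : ℝ | ε < |x - y|}.indicator (fun y : ℝ => ((x - y : ℝ) : ℂ)⁻¹) s := by
    refine integrable_mul_of_norm_le hp₁ hp₂ hf (C := 1 + (1 + |x|) / ε) ?_ fun s => ?_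
    · refine Measurable.indicator (by fun_prop) ?_
      exact measurableSet_lt measurable_const (by fun_prop)
    · by_cases h : ε < |x - s|
      · have h' : 0 < |x - s| := hε.trans h
        rw [indicator_of_mem (by exact h), norm_inv, Complex.norm_real, Real.norm_eq_abs,
          ← div_eq_mul_inv, inv_le_comm₀ h' (by positivity), inv_div,
          div_le_iff₀ (by positivity)]
        have h1 : |s| ≤ |x - s| + |x| := by
          have := abs_sub_abs_le_abs_sub s x
          rw [abs_sub_comm] at this
          linarith
        have h2 : 1 + |x| ≤ |x - s| * ((1 + |x|) / ε) := by
          rw [mul_div_assoc', le_div_iff₀ hε]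
          nlinarith [abs_nonneg x]
        linarith
      · rw [indicator_of_notMem (by exact h), norm_zero]
        positivity
  have i2 := integrable_mul_inv_ofReal_sub hp₁ hp₂ hf hz
  have e1 : ∀ s : ℝ, hilbertDiffKernel ε (x - s) =
      {y : ℝ | ε < |x - y|}.indicator (fun y : ℝ => ((x - y : ℝ) : ℂ)⁻¹) s +
        ((s : ℂ) - starRingEnd ℂ (x + ε * Complex.I : ℂ))⁻¹ := by
    intro s
    unfold hilbertDiffKernel
    have h1 : {u : ℝ | ε < |u|}.indicator (fun u : ℝ => (u : ℂ)⁻¹) (x - s) =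
        {y : ℝ | ε < |x - y|}.indicator (fun y : ℝ => ((x - y : ℝ) : ℂ)⁻¹) s := rfl
    have h2 : -(((x - s : ℝ) : ℂ) - ε * Complex.I) =
        (s : ℂ) - starRingEnd ℂ (x + ε * Complex.I : ℂ) := by
      simp
      ring
    rw [sub_eq_add_neg, ← inv_neg, h1, h2]
  have i3 : Integrable fun s => f s * hilbertDiffKernel ε (x - s) := by
    simp_rw [e1, mul_add]
    exact i1.add i2
  have e2 : ∫ s, f s * hilbertDiffKernel ε (x - s) =
      ∫ y in {y : ℝ | ε < |x - y|}, f y / ((x - y : ℝ) : ℂ) := by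
    simp_rw [e1, mul_add]
    have h0 := hC _ hz'
    unfold cauchyTransform at h0
    rw [integral_add i1 i2, h0, add_zero, ← integral_indicator]
    · congr 1 with s
      by_cases h : ε < |x - s|
      · rw [indicator_of_mem (by exact h), indicator_of_mem (by exact h), div_eq_mul_inv]
      · rw [indicator_of_notMem (by exact h), indicator_of_notMem (by exact h), mul_zero]
    · exact measurableSet_lt measurable_const (by fun_prop)
  have e3 : ∫ s, (f s - f x) * hilbertDiffKernel ε (x - s) =
      (∫ y in {y : ℝ | ε < |x - y|}, f y / ((x - y : ℝ) : ℂ)) - f x * -(Real.pi * Complex.I) := by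
    simp_rw [sub_mul]
    rw [integral_sub i3 (((integrable_hilbertDiffKernel hε).comp_sub_left x).const_mul _), e2,
      integral_const_mul, integral_sub_left_eq_self (hilbertDiffKernel ε),
      integral_hilbertDiffKernel hε]
  rw [e3]
  unfold truncatedHilbert
  push_cast
  field_simp

/-- The Hilbert transform of a function in the Hardy space is `-i` times the function. -/
theorem isHilbertTransform_neg_I_mul {p : ℝ≥0∞} (hp₁ : 1 < p) (hp₂ : p < ∞) {f : ℝ → ℂ}
    (hf : MemLp f p) (hC : ∀ z : ℂ, 0 < z.im → cauchyTransform f (starRingEnd ℂ z) = 0) :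
    IsHilbertTransform f fun x => -Complex.I * f x := by
  filter_upwards [ae_average_norm_sub hp₁.le hp₂ hf] with x ⟨hx, M, hM⟩
  have hfm : AEStronglyMeasurable (fun s => f s - f x) := hf.1.sub aestronglyMeasurable_const
  have hg : LocallyIntegrable fun s => ‖f s - f x‖ :=
    ((hf.locallyIntegrable hp₁.le).sub (locallyIntegrable_const (f x))).mono hfm.norm
      (Eventually.of_forall fun s => by simp)
  have key := tendsto_lintegral_mul_poisson (fun s => norm_nonneg (f s - f x)) hg hM hx
  rw [tendsto_iff_norm_sub_tendsto_zero]
  have key2 := ((ENNReal.tendsto_toReal ENNReal.zero_ne_top).comp key).const_mul (1 / Real.pi * 2)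
  rw [ENNReal.toReal_zero, mul_zero] at key2
  refine squeeze_zero' (Eventually.of_forall fun _ => norm_nonneg _) ?_ key2
  -- Finiteness of the Poisson integral is needed, since `toReal` sends `∞` to `0` and the
  -- comparison would fail.
  filter_upwards [self_mem_nhdsWithin, key.eventually (gt_mem_nhds one_pos)] with ε hε hfin
  rw [truncatedHilbert_add_eq hp₁ hp₂ hf hC hε, norm_mul, Complex.norm_real,
    Real.norm_of_nonneg (by positivity), mul_assoc]
  gcongr
  refine (norm_integral_le_lintegral_norm _).trans ?_
  have h2 : (2 : ℝ) = (2 : ℝ≥0∞).toReal := by simp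
  simp only [Function.comp]
  rw [h2, ← ENNReal.toReal_mul]
  refine ENNReal.toReal_mono (ENNReal.mul_ne_top (by simp) (hfin.trans ENNReal.one_lt_top).ne) ?_
  rw [← lintegral_const_mul' _ _ (by simp)]
  refine lintegral_mono fun s => ?_
  rw [← ENNReal.ofReal_ofNat 2, ← ENNReal.ofReal_mul (by norm_num)]
  apply ENNReal.ofReal_le_ofReal
  rw [norm_mul]
  calc ‖f s - f x‖ * ‖hilbertDiffKernel ε (x - s)‖
      ≤ ‖f s - f x‖ * (2 * (ε / ((x - s) ^ 2 + ε ^ 2))) := by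
        gcongr
        exact norm_hilbertDiffKernel_le hε _
    _ = _ := by ring

/-! ### Dilations and their averages in `L^p` -/

theorem eLpNorm_rpow_toReal {α : Type*} [MeasurableSpace α] {μ : Measure α} {p : ℝ≥0∞}
    (hp₁ : 1 ≤ p) (hp₂ : p < ∞) (h : α → ℂ) :
    eLpNorm h p μ ^ p.toReal = ∫⁻ x, ‖h x‖ₑ ^ p.toReal ∂μ := by
  have hp : 0 < p.toReal := ENNReal.toReal_pos (by positivity) hp₂.ne
  rw [eLpNorm_eq_lintegral_rpow_enorm_toReal (by positivity) hp₂.ne, ← ENNReal.rpow_mul,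
    one_div_mul_cancel hp.ne', ENNReal.rpow_one]

/-- Jensen's inequality for powers, over a measure that need not be a probability measure. -/
theorem lintegral_rpow_le_measure_univ_mul {α : Type*} [MeasurableSpace α] {ν : Measure α} {r : ℝ}
    (hr : 1 < r) {g : α → ℝ≥0∞} (hg : AEMeasurable g ν) :
    (∫⁻ t, g t ∂ν) ^ r ≤ ν univ ^ (r - 1) * ∫⁻ t, g t ^ r ∂ν := by
  have hpq := Real.HolderConjugate.conjExponent hr
  have h := ENNReal.lintegral_mul_le_Lp_mul_Lq ν hpq hg (aemeasurable_const (b := (1 : ℝ≥0∞)))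
  simp only [Pi.mul_apply, mul_one, ENNReal.one_rpow, lintegral_const, one_mul] at h
  have hr0 : 0 < r := by linarith
  calc (∫⁻ t, g t ∂ν) ^ r
      ≤ ((∫⁻ t, g t ^ r ∂ν) ^ (1 / r) * ν univ ^ (1 / r.conjExponent)) ^ r := by gcongr
    _ = _ := by
      rw [ENNReal.mul_rpow_of_nonneg _ _ hr0.le, ← ENNReal.rpow_mul, ← ENNReal.rpow_mul,
        one_div_mul_cancel hr0.ne', ENNReal.rpow_one, mul_comm]
      congr 2
      unfold Real.conjExponent
      have : r - 1 ≠ 0 := by linarith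
      field_simp

theorem lintegral_lintegral_rpow_le {ν : Measure ℝ} [IsFiniteMeasure ν] {r : ℝ} (hr : 1 < r)
    {G : ℝ → ℝ → ℝ≥0∞} (hG : Measurable (Function.uncurry G)) :
    ∫⁻ x, (∫⁻ t, G t x ∂ν) ^ r ≤ ν univ ^ (r - 1) * ∫⁻ t, (∫⁻ x, G t x ^ r) ∂ν := by
  have hGr : Measurable (Function.uncurry fun t x => G t x ^ r) := hG.pow_const r
  calc ∫⁻ x, (∫⁻ t, G t x ∂ν) ^ r
      ≤ ∫⁻ x, ν univ ^ (r - 1) * ∫⁻ t, G t x ^ r ∂ν := by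
        refine lintegral_mono fun x => lintegral_rpow_le_measure_univ_mul hr ?_
        exact (hG.comp measurable_prodMk_right).aemeasurable
    _ = ν univ ^ (r - 1) * ∫⁻ x, (∫⁻ t, G t x ^ r ∂ν) :=
        lintegral_const_mul _ hGr.lintegral_prod_left'
    _ = _ := by
        rw [lintegral_lintegral_swap]
        exact (hGr.comp measurable_swap).aemeasurable

/-- A substitute for Minkowski's integral inequality over a finite measure. -/
theorem eLpNorm_integral_rpow_le {ν : Measure ℝ} [IsFiniteMeasure ν] {p : ℝ≥0∞} (hp₁ : 1 < p)
    (hp₂ : p < ∞) {F : ℝ → ℝ → ℂ} (hF : Measurable (Function.uncurry F)) :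
    eLpNorm (fun x => ∫ t, F t x ∂ν) p volume ^ p.toReal ≤
      ν univ ^ (p.toReal - 1) * ∫⁻ t, eLpNorm (F t) p volume ^ p.toReal ∂ν := by
  have hr : 1 < p.toReal := one_lt_toReal hp₁ hp₂
  simp_rw [eLpNorm_rpow_toReal hp₁.le hp₂]
  refine le_trans (lintegral_mono fun x => ?_)
    (lintegral_lintegral_rpow_le (G := fun t x => ‖F t x‖ₑ) hr hF.enorm)
  gcongr
  exact enorm_integral_le_lintegral_enorm _

/-- The `L^p`-normalized dilation, with `r` the exponent. -/
def dilation (r t : ℝ) (f : ℝ → ℂ) (x : ℝ) : ℂ := ((t ^ (-(1 / r)) : ℝ) : ℂ) * f (x / t)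

theorem measurable_uncurry_dilation (r : ℝ) {f : ℝ → ℂ} (hf : Measurable f) :
    Measurable (Function.uncurry fun t x => dilation r t f x) := by
  refine Measurable.mul ?_ (hf.comp (measurable_snd.div measurable_fst))
  exact Complex.measurable_ofReal.comp (measurable_fst.pow_const _)

theorem lintegral_comp_div_pos (g : ℝ → ℝ≥0∞) {t : ℝ} (ht : 0 < t) :
    ∫⁻ x, g (x / t) = ENNReal.ofReal t * ∫⁻ x, g x := by
  have h := Real.map_volume_mul_right (inv_ne_zero ht.ne')
  have e : MeasurableEmbedding fun x : ℝ => x * t⁻¹ :=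
    (Homeomorph.mulRight₀ t⁻¹ (inv_ne_zero ht.ne')).measurableEmbedding
  simp_rw [div_eq_mul_inv]
  rw [← e.lintegral_map, h, lintegral_smul_measure, inv_inv, abs_of_pos ht, smul_eq_mul]

theorem eLpNorm_dilation {p : ℝ≥0∞} (hp₁ : 1 ≤ p) (hp₂ : p < ∞) (f : ℝ → ℂ) {t : ℝ} (ht : 0 < t) :
    eLpNorm (dilation p.toReal t f) p volume = eLpNorm f p volume := by
  have hp : 0 < p.toReal := ENNReal.toReal_pos (by positivity) hp₂.ne
  refine (ENNReal.strictMono_rpow_of_pos hp).injective ?_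
  simp only [eLpNorm_rpow_toReal hp₁ hp₂]
  have : ∀ x, ‖dilation p.toReal t f x‖ₑ ^ p.toReal =
      ENNReal.ofReal t⁻¹ * ‖f (x / t)‖ₑ ^ p.toReal := by
    intro x
    unfold dilation
    rw [enorm_mul, ENNReal.mul_rpow_of_nonneg _ _ hp.le]
    congr 1
    rw [← ofReal_norm, Complex.norm_real, Real.norm_of_nonneg (by positivity),
      ENNReal.ofReal_rpow_of_nonneg (by positivity) hp.le, ← Real.rpow_mul ht.le, neg_mul,
      one_div_mul_cancel hp.ne', Real.rpow_neg_one]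
  simp_rw [this]
  rw [lintegral_const_mul' _ _ ENNReal.ofReal_ne_top,
    lintegral_comp_div_pos (fun x => ‖f x‖ₑ ^ p.toReal) ht, ← mul_assoc,
    ← ENNReal.ofReal_mul (by positivity), inv_mul_cancel₀ ht.ne', ENNReal.ofReal_one, one_mul]

/-- The average of the normalized dilations of `f` with respect to `ν`. -/
def dilationAverage (ν : Measure ℝ) (r : ℝ) (f : ℝ → ℂ) (x : ℝ) : ℂ :=
  ∫ t, dilation r t f x ∂ν

section DilationAverage

variable {ν : Measure ℝ} [IsFiniteMeasure ν] {p : ℝ≥0∞} {f : ℝ → ℂ}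

theorem stronglyMeasurable_dilationAverage (r : ℝ) (hfm : Measurable f) :
    StronglyMeasurable (dilationAverage ν r f) :=
  (measurable_uncurry_dilation r hfm).stronglyMeasurable.integral_prod_left'

/-- All the dilations have the norm of `f`, so Jensen loses nothing against Minkowski: the powers of
the mass combine as `ν^(p-1) · ν = ν^p`. -/
theorem eLpNorm_dilationAverage_le (hν : ∀ᵐ t ∂ν, 0 < t) (hp₁ : 1 < p) (hp₂ : p < ∞)
    (hfm : Measurable f) :
    eLpNorm (dilationAverage ν p.toReal f) p volume ≤ ν univ * eLpNorm f p volume := by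
  have hp : 0 < p.toReal := ENNReal.toReal_pos (by positivity) hp₂.ne
  rw [← ENNReal.rpow_le_rpow_iff hp]
  refine (eLpNorm_integral_rpow_le hp₁ hp₂ (measurable_uncurry_dilation p.toReal hfm)).trans ?_
  have : ∫⁻ t, eLpNorm (dilation p.toReal t f) p volume ^ p.toReal ∂ν =
      eLpNorm f p volume ^ p.toReal * ν univ := by
    rw [← lintegral_const]
    refine lintegral_congr_ae ?_
    filter_upwards [hν] with t ht
    rw [eLpNorm_dilation hp₁.le hp₂ f ht]
  have h1 : ν univ ^ (p.toReal - 1) * ν univ = ν univ ^ p.toReal := by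
    have hr : 1 < p.toReal := one_lt_toReal hp₁ hp₂
    conv_lhs => rw [← ENNReal.rpow_one (ν univ), ← ENNReal.rpow_mul,
      ← ENNReal.rpow_add_of_nonneg _ _ (by linarith) zero_le_one]
    simp
  change ν univ ^ (p.toReal - 1) * ∫⁻ t, eLpNorm (dilation p.toReal t f) p volume ^ p.toReal ∂ν ≤ _
  rw [this, ENNReal.mul_rpow_of_nonneg _ _ hp.le, ← h1]
  exact le_of_eq (by ring)

theorem memLp_dilationAverage (hν : ∀ᵐ t ∂ν, 0 < t) (hp₁ : 1 < p) (hp₂ : p < ∞)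
    (hfm : Measurable f) (hf : MemLp f p) : MemLp (dilationAverage ν p.toReal f) p :=
  ⟨(stronglyMeasurable_dilationAverage _ hfm).aestronglyMeasurable,
    (eLpNorm_dilationAverage_le hν hp₁ hp₂ hfm).trans_lt
      (ENNReal.mul_lt_top (measure_lt_top _ _) hf.2)⟩

/-- With the absolute value inside the inner integral, this yields both absolute convergence almost
everywhere and the majorant needed for Fubini. -/
theorem lintegral_enorm_dilation_rpow_lt_top (hν : ∀ᵐ t ∂ν, 0 < t) (hp₁ : 1 < p) (hp₂ : p < ∞)
    (hfm : Measurable f) (hf : MemLp f p) :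
    ∫⁻ x, (∫⁻ t, ‖dilation p.toReal t f x‖ₑ ∂ν) ^ p.toReal < ∞ := by
  have hp : 0 < p.toReal := ENNReal.toReal_pos (by positivity) hp₂.ne
  have hr : 1 < p.toReal := one_lt_toReal hp₁ hp₂
  refine (lintegral_lintegral_rpow_le (G := fun t x => ‖dilation p.toReal t f x‖ₑ) hr
    (measurable_uncurry_dilation p.toReal hfm).enorm).trans_lt ?_
  refine ENNReal.mul_lt_top (ENNReal.rpow_lt_top_of_nonneg (by linarith) (measure_ne_top _ _)) ?_
  have : ∫⁻ t, (∫⁻ x, ‖dilation p.toReal t f x‖ₑ ^ p.toReal) ∂ν =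
      eLpNorm f p volume ^ p.toReal * ν univ := by
    rw [← lintegral_const]
    refine lintegral_congr_ae ?_
    filter_upwards [hν] with t ht
    rw [← eLpNorm_dilation hp₁.le hp₂ f ht, eLpNorm_rpow_toReal hp₁.le hp₂]
  rw [this]
  exact ENNReal.mul_lt_top (ENNReal.rpow_lt_top_of_nonneg hp.le hf.2.ne) (measure_lt_top _ _)

theorem ae_integrable_dilation (hν : ∀ᵐ t ∂ν, 0 < t) (hp₁ : 1 < p) (hp₂ : p < ∞)
    (hfm : Measurable f) (hf : MemLp f p) :
    ∀ᵐ x : ℝ, Integrable (fun t => dilation p.toReal t f x) ν := by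
  have hp : 0 < p.toReal := ENNReal.toReal_pos (by positivity) hp₂.ne
  have hm := measurable_uncurry_dilation p.toReal hfm
  have h := ae_lt_top (hm.enorm.lintegral_prod_left'.pow_const p.toReal)
    (lintegral_enorm_dilation_rpow_lt_top hν hp₁ hp₂ hfm hf).ne
  filter_upwards [h] with x hx
  refine ⟨(hm.comp measurable_prodMk_right).aestronglyMeasurable, ?_⟩
  exact (ENNReal.rpow_lt_top_iff_of_pos hp).1 hx

theorem cauchyTransform_dilation (r : ℝ) {t : ℝ} (ht : 0 < t) (w : ℂ) :
    cauchyTransform (dilation r t f) w =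
      ((t ^ (-(1 / r)) : ℝ) : ℂ) * cauchyTransform f (w / t) := by
  have ht' : (t : ℂ) ≠ 0 := by exact_mod_cast ht.ne'
  have h : ∀ s : ℝ, dilation r t f s * ((s : ℂ) - w)⁻¹ = ((t ^ (-(1 / r)) : ℝ) : ℂ) * (t : ℂ)⁻¹ *
      (fun u : ℝ => f u * ((u : ℂ) - w / t)⁻¹) (s / t) := by
    intro s
    have : ((s / t : ℝ) : ℂ) - w / t = (t : ℂ)⁻¹ * (s - w) := by
      push_cast; field_simp
    simp only [dilation]
    rw [this, mul_inv, inv_inv]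
    field_simp
  unfold cauchyTransform
  simp_rw [h]
  rw [integral_const_mul, Measure.integral_comp_div (fun u : ℝ => f u * ((u : ℂ) - w / t)⁻¹),
    abs_of_pos ht, Complex.real_smul]
  field_simp

/-- Averages of dilations preserve the vanishing of the Cauchy transform on the lower
half-plane. -/
theorem cauchyTransform_dilationAverage (hν : ∀ᵐ t ∂ν, 0 < t) (hp₁ : 1 < p) (hp₂ : p < ∞)
    (hfm : Measurable f) (hf : MemLp f p)
    (hC : ∀ z : ℂ, 0 < z.im → cauchyTransform f (starRingEnd ℂ z) = 0) {z : ℂ} (hz : 0 < z.im) :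
    cauchyTransform (dilationAverage ν p.toReal f) (starRingEnd ℂ z) = 0 := by
  have hp : 0 < p.toReal := ENNReal.toReal_pos (by positivity) hp₂.ne
  have hz' : (starRingEnd ℂ z).im ≠ 0 := by simpa using hz.ne'
  have hm := measurable_uncurry_dilation p.toReal hfm
  set w := starRingEnd ℂ z with hw
  -- The average of the absolute values is itself in `L^p`, hence integrable against the Cauchy
  -- kernel; this justifies exchanging the integrals.
  have hN : MemLp (fun x => ((∫ t, ‖dilation p.toReal t f x‖ ∂ν : ℝ) : ℂ)) p := by
    refine ⟨?_, ?_⟩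
    · exact (Complex.measurable_ofReal.comp
        hm.norm.stronglyMeasurable.integral_prod_left'.measurable).aestronglyMeasurable
    · rw [← ENNReal.rpow_lt_top_iff_of_pos hp, eLpNorm_rpow_toReal hp₁.le hp₂]
      refine lt_of_le_of_lt (lintegral_mono fun x => ?_)
        (lintegral_enorm_dilation_rpow_lt_top hν hp₁ hp₂ hfm hf)
      gcongr
      rw [← ofReal_norm, Complex.norm_real, ofReal_norm]
      refine (enorm_integral_le_lintegral_enorm _).trans (le_of_eq ?_)
      simp
  have hint : Integrable (Function.uncurry fun s t =>
      dilation p.toReal t f s * ((s : ℂ) - w)⁻¹) (volume.prod ν) := by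
    have hmeas : Measurable (Function.uncurry fun s t =>
        dilation p.toReal t f s * ((s : ℂ) - w)⁻¹) :=
      (hm.comp measurable_swap).mul ((measurable_inv_ofReal_sub w).comp measurable_fst)
    refine (integrable_prod_iff hmeas.aestronglyMeasurable).2 ⟨?_, ?_⟩
    · filter_upwards [ae_integrable_dilation hν hp₁ hp₂ hfm hf] with s hs
      exact hs.mul_const ((s : ℂ) - w)⁻¹
    · refine (integrable_mul_inv_ofReal_sub hp₁ hp₂ hN hz').norm.congr
        (Eventually.of_forall fun s => ?_)
      simp only [Function.uncurry, norm_mul]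
      rw [integral_mul_const, Complex.norm_real, Real.norm_of_nonneg (integral_nonneg fun t =>
        norm_nonneg _)]
  have h1 : cauchyTransform (dilationAverage ν p.toReal f) w =
      ∫ s : ℝ, ∫ t, dilation p.toReal t f s * ((s : ℂ) - w)⁻¹ ∂ν := by
    unfold cauchyTransform dilationAverage
    simp_rw [integral_mul_const]
  rw [h1, integral_integral_swap hint]
  refine integral_eq_zero_of_ae ?_
  filter_upwards [hν] with t ht
  have h2 : w / t = starRingEnd ℂ (z / t) := by simp [hw]
  change cauchyTransform (dilation p.toReal t f) w = 0
  rw [cauchyTransform_dilation _ ht, h2, hC, mul_zero]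
  rw [Complex.div_ofReal_im]
  positivity

/-- Functions that agree almost everywhere have the same dilation averages almost everywhere. -/
theorem dilationAverage_congr_ae (hν : ∀ᵐ t ∂ν, 0 < t) (r : ℝ) {g : ℝ → ℂ} (hfm : Measurable f)
    (hgm : Measurable g) (h : f =ᵐ[volume] g) :
    dilationAverage ν r f =ᵐ[volume] dilationAverage ν r g := by
  have hms : MeasurableSet {q : ℝ × ℝ | f (q.2 / q.1) = g (q.2 / q.1)} :=
    measurableSet_eq_fun (hfm.comp (measurable_snd.div measurable_fst))
      (hgm.comp (measurable_snd.div measurable_fst))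
  have h1 : ∀ᵐ t ∂ν, ∀ᵐ x : ℝ, f (x / t) = g (x / t) := by
    filter_upwards [hν] with t ht
    have hq : Measure.QuasiMeasurePreserving (fun x : ℝ => x / t) volume volume := by
      simp_rw [div_eq_mul_inv]
      refine ⟨by fun_prop, ?_⟩
      rw [Real.map_volume_mul_right (inv_ne_zero ht.ne')]
      exact Measure.smul_absolutelyContinuous
    exact hq.ae h
  -- The exceptional null set in `x` depends on `t`; Fubini exchanges the two quantifiers.
  have h2 := (Measure.ae_ae_comm (p := fun t x : ℝ => f (x / t) = g (x / t)) hms).1 h1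
  filter_upwards [h2] with x hx
  refine integral_congr_ae ?_
  filter_upwards [hx] with t ht
  simp only [dilation, ht]

end DilationAverage

theorem measurable_coe_Lp {p : ℝ≥0∞} (f : Lp ℂ p (volume : Measure ℝ)) : Measurable f :=
  (Lp.stronglyMeasurable f).measurable

theorem memLp_dilationAverage_coe {ν : Measure ℝ} [IsFiniteMeasure ν] {p : ℝ≥0∞}
    (hν : ∀ᵐ t ∂ν, 0 < t) (hp₁ : 1 < p) (hp₂ : p < ∞) (f : Lp ℂ p (volume : Measure ℝ)) : MemLp (dilationAverage ν p.toReal f) p :=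
  memLp_dilationAverage hν hp₁ hp₂ (measurable_coe_Lp f) (Lp.memLp f)

/-! ### The averaging operator on the Hardy space -/

section Operator

variable {ν : Measure ℝ} [IsFiniteMeasure ν] {p : ℝ≥0∞} [Fact (1 ≤ p)]

/-- The average of the dilations of an element of the Hardy space, as an element of that space. -/
def dilationAverageHardy (hν : ∀ᵐ t ∂ν, 0 < t) (hp₁ : 1 < p) (hp₂ : p < ∞) (f : HardyPlus p) :
    HardyPlus p :=
  ⟨(memLp_dilationAverage_coe hν hp₁ hp₂ f.1).toLp _, by
    rw [mem_hardyPlus_iff hp₁ hp₂]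
    intro z hz
    rw [cauchyTransform_congr_ae (MemLp.coeFn_toLp _)]
    exact cauchyTransform_dilationAverage hν hp₁ hp₂ (measurable_coe_Lp f.1) (Lp.memLp f.1)
      ((mem_hardyPlus_iff hp₁ hp₂ f.1).1 f.2) hz⟩

theorem coeFn_dilationAverageHardy (hν : ∀ᵐ t ∂ν, 0 < t) (hp₁ : 1 < p) (hp₂ : p < ∞)
    (f : HardyPlus p) :
    (dilationAverageHardy hν hp₁ hp₂ f : Lp ℂ p (volume : Measure ℝ)) =ᵐ[volume]
      dilationAverage ν p.toReal (f : Lp ℂ p (volume : Measure ℝ)) :=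
  MemLp.coeFn_toLp (memLp_dilationAverage_coe hν hp₁ hp₂ f.1)

theorem norm_dilationAverageHardy_le (hν : ∀ᵐ t ∂ν, 0 < t) (hp₁ : 1 < p) (hp₂ : p < ∞)
    (f : HardyPlus p) : ‖dilationAverageHardy hν hp₁ hp₂ f‖ ≤ (ν univ).toReal * ‖f‖ := by
  change ‖(memLp_dilationAverage_coe hν hp₁ hp₂ f.1).toLp _‖ ≤ _ * ‖f.1‖
  rw [Lp.norm_toLp, Lp.norm_def, ← ENNReal.toReal_mul]
  exact ENNReal.toReal_mono (ENNReal.mul_ne_top (measure_ne_top _ _) (Lp.memLp f.1).2.ne)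
    (eLpNorm_dilationAverage_le hν hp₁ hp₂ (measurable_coe_Lp f.1))

/-- Averages of dilations as a bounded operator on the Hardy space. -/
def dilationAverageCLM (hν : ∀ᵐ t ∂ν, 0 < t) (hp₁ : 1 < p) (hp₂ : p < ∞) :
    HardyPlus p →L[ℂ] HardyPlus p :=
  LinearMap.mkContinuous
    { toFun := dilationAverageHardy hν hp₁ hp₂
      map_add' := by
        intro f g
        refine Subtype.ext (Lp.ext ?_)
        refine (coeFn_dilationAverageHardy hν hp₁ hp₂ (f + g)).trans
          (EventuallyEq.trans ?_ (Lp.coeFn_add _ _).symm)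
        refine (dilationAverage_congr_ae hν p.toReal (measurable_coe_Lp _)
          ((measurable_coe_Lp f.1).add (measurable_coe_Lp g.1)) (Lp.coeFn_add f.1 g.1)).trans ?_
        filter_upwards [coeFn_dilationAverageHardy hν hp₁ hp₂ f,
          coeFn_dilationAverageHardy hν hp₁ hp₂ g,
          ae_integrable_dilation hν hp₁ hp₂ (measurable_coe_Lp f.1) (Lp.memLp f.1),
          ae_integrable_dilation hν hp₁ hp₂ (measurable_coe_Lp g.1) (Lp.memLp g.1)]
          with x h1 h2 h3 h4
        rw [Pi.add_apply, h1, h2]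
        unfold dilationAverage
        rw [← integral_add h3 h4]
        simp only [dilation, Pi.add_apply, mul_add]
      map_smul' := by
        intro c f
        refine Subtype.ext (Lp.ext ?_)
        refine (coeFn_dilationAverageHardy hν hp₁ hp₂ (c • f)).trans
          (EventuallyEq.trans ?_ (Lp.coeFn_smul _ _).symm)
        refine (dilationAverage_congr_ae hν p.toReal (measurable_coe_Lp _)
          ((measurable_coe_Lp f.1).const_smul c) (Lp.coeFn_smul c f.1)).trans ?_
        filter_upwards [coeFn_dilationAverageHardy hν hp₁ hp₂ f] with x h1
        rw [Pi.smul_apply, RingHom.id_apply, h1, smul_eq_mul]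
        unfold dilationAverage
        rw [← integral_const_mul]
        simp only [dilation, Pi.smul_apply, smul_eq_mul, mul_left_comm] }
    (ν univ).toReal (norm_dilationAverageHardy_le hν hp₁ hp₂)

theorem coeFn_dilationAverageCLM (hν : ∀ᵐ t ∂ν, 0 < t) (hp₁ : 1 < p) (hp₂ : p < ∞)
    (f : HardyPlus p) :
    (dilationAverageCLM hν hp₁ hp₂ f : Lp ℂ p (volume : Measure ℝ)) =ᵐ[volume]
      dilationAverage ν p.toReal (f : Lp ℂ p (volume : Measure ℝ)) :=
  coeFn_dilationAverageHardy hν hp₁ hp₂ f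

theorem norm_dilationAverageCLM_le (hν : ∀ᵐ t ∂ν, 0 < t) (hp₁ : 1 < p) (hp₂ : p < ∞) :
    ‖dilationAverageCLM hν hp₁ hp₂‖ ≤ (ν univ).toReal :=
  LinearMap.mkContinuous_norm_le _ ENNReal.toReal_nonneg _

end Operator

/-! ### The test functions `(x + i)^(-a)` -/

theorem ofReal_mul_cpow_ofReal {c : ℝ} (hc : 0 < c) {z : ℂ} (hz : z ≠ 0) (s : ℝ) :
    ((c : ℂ) * z) ^ (s : ℂ) = ((c ^ s : ℝ) : ℂ) * z ^ (s : ℂ) := by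
  have hc' : (c : ℂ) ≠ 0 := by exact_mod_cast hc.ne'
  rw [Complex.ofReal_cpow hc.le, Complex.cpow_def_of_ne_zero (mul_ne_zero hc' hz),
    Complex.cpow_def_of_ne_zero hc', Complex.cpow_def_of_ne_zero hz, ← Complex.exp_add,
    Complex.log_ofReal_mul hc hz, Complex.ofReal_log hc.le]
  ring_nf

/-- The boundary values of the function `(z + i τ)^(-a)`. -/
def shiftedPower (a τ : ℝ) (x : ℝ) : ℂ := ((x : ℂ) + τ * Complex.I) ^ ((-a : ℝ) : ℂ)

theorem mem_slitPlane_of_im_pos {z : ℂ} (hz : 0 < z.im) : z ∈ Complex.slitPlane :=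
  Complex.mem_slitPlane_iff.2 (Or.inr hz.ne')

theorem im_ofReal_add_mul_I (x τ : ℝ) : ((x : ℂ) + τ * Complex.I).im = τ := by simp

theorem norm_ofReal_add_mul_I (x τ : ℝ) : ‖(x : ℂ) + τ * Complex.I‖ = √(x ^ 2 + τ ^ 2) := by
  rw [Complex.norm_def, Complex.normSq_apply]
  simp [sq]

theorem norm_shiftedPower (a τ x : ℝ) : ‖shiftedPower a τ x‖ = √(x ^ 2 + τ ^ 2) ^ (-a) := by
  rw [shiftedPower, Complex.norm_cpow_real, norm_ofReal_add_mul_I]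

theorem continuous_shiftedPower (a : ℝ) {τ : ℝ} (hτ : 0 < τ) : Continuous (shiftedPower a τ) := by
  refine Continuous.cpow (by fun_prop) continuous_const fun x => mem_slitPlane_of_im_pos ?_
  rwa [im_ofReal_add_mul_I]

/-- Since `x/t + i = (x + it)/t`, a dilation only moves the branch point from `-i` to `-it`, up to a
factor tending to `1` as `a → 1/r`. -/
theorem dilation_shiftedPower (r a x : ℝ) {t : ℝ} (ht : 0 < t) :
    dilation r t (shiftedPower a 1) x = ((t ^ (a - 1 / r) : ℝ) : ℂ) * shiftedPower a t x := by
  unfold dilation shiftedPower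
  have ht' : (t : ℂ) ≠ 0 := by exact_mod_cast ht.ne'
  have h0 : (x : ℂ) + t * Complex.I ≠ 0 :=
    Complex.slitPlane_ne_zero (mem_slitPlane_of_im_pos (by rwa [im_ofReal_add_mul_I]))
  have h1 : ((x / t : ℝ) : ℂ) + (1 : ℝ) * Complex.I =
      ((t⁻¹ : ℝ) : ℂ) * ((x : ℂ) + t * Complex.I) := by
    push_cast; field_simp
  have h2 : t ^ (-(1 / r)) * t⁻¹ ^ (-a) = t ^ (a - 1 / r) := by
    rw [Real.inv_rpow ht.le, ← Real.rpow_neg ht.le, ← Real.rpow_add ht]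
    ring_nf
  rw [h1, ofReal_mul_cpow_ofReal (inv_pos.2 ht) h0, ← mul_assoc, ← Complex.ofReal_mul, h2]

theorem memLp_shiftedPower {p : ℝ≥0∞} (hp₁ : 1 ≤ p) (hp₂ : p < ∞) {a : ℝ}
    (ha : 1 < a * p.toReal) : MemLp (shiftedPower a 1) p := by
  have hm : AEStronglyMeasurable (shiftedPower a 1) :=
    (continuous_shiftedPower a one_pos).aestronglyMeasurable
  rw [← integrable_norm_rpow_iff hm (by positivity) hp₂.ne]
  refine (integrable_rpow_neg_one_add_norm_sq (E := ℝ) (r := a * p.toReal) (by simpa using ha)).congr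
    (Eventually.of_forall fun x => ?_)
  simp only [norm_shiftedPower]
  rw [Real.norm_eq_abs, sq_abs, one_pow, Real.sqrt_eq_rpow, ← Real.rpow_mul (by positivity),
    ← Real.rpow_mul (by positivity), add_comm]
  ring_nf

/-- If `g` is holomorphic on the closed upper half-plane and decays faster than `1 / |z|`,
then its integral over the real axis vanishes. -/
theorem integral_eq_zero_of_norm_le {g : ℂ → ℂ} (hg : ∀ z : ℂ, 0 ≤ z.im → DifferentiableAt ℂ g z)
    {a C R₀ : ℝ} (ha : 0 < a)
    (hbound : ∀ R, R₀ ≤ R → ∀ z : ℂ, 0 ≤ z.im → R ≤ ‖z‖ → ‖g z‖ ≤ C * (R ^ (-a) * R⁻¹))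
    (hint : Integrable fun x : ℝ => g x) : ∫ x : ℝ, g x = 0 := by
  have hlim : Tendsto (fun R : ℝ => ∫ x in (-R)..R, g x) atTop (𝓝 (∫ x : ℝ, g x)) :=
    intervalIntegral_tendsto_integral hint tendsto_neg_atTop_atBot tendsto_id
  have hzero : Tendsto (fun R : ℝ => 4 * C * R ^ (-a)) atTop (𝓝 0) := by
    simpa using (tendsto_rpow_neg_atTop ha).const_mul (4 * C)
  refine tendsto_nhds_unique hlim (squeeze_zero_norm' ?_ hzero)
  filter_upwards [eventually_ge_atTop R₀, eventually_gt_atTop 0] with R hR hR0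
  -- Cauchy's theorem on `[-R, R] × [0, R]`. The three sides off the real axis have total length
  -- `4R` and lie in `|z| ≥ R`, whence the bound `4 C R^(-a)`.
  have hrect := Complex.integral_boundary_rect_eq_zero_of_differentiableOn g (-R : ℂ)
    (R + R * Complex.I : ℂ) (fun z hz => by
      refine (hg z ?_).differentiableWithinAt
      have h := hz.2
      simp only [mem_preimage, Complex.neg_im, Complex.ofReal_im, neg_zero, Complex.add_im,
        Complex.mul_im, Complex.ofReal_re, Complex.I_im, mul_one, Complex.I_re, mul_zero,
        add_zero, zero_add] at h
      rw [uIcc_of_le hR0.le] at h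
      exact h.1)
  simp only [Complex.neg_re, Complex.neg_im, Complex.ofReal_re, Complex.ofReal_im, neg_zero,
    Complex.add_re, Complex.add_im, Complex.mul_re, Complex.mul_im, Complex.I_re, Complex.I_im,
    mul_zero, mul_one, zero_mul, sub_zero, add_zero, zero_add, Complex.ofReal_zero,
    Complex.ofReal_neg, smul_eq_mul] at hrect
  have key : ∀ z : ℂ, 0 ≤ z.im → R ≤ ‖z‖ → ‖g z‖ ≤ C * (R ^ (-a) * R⁻¹) := hbound R hR
  have b1 : ‖∫ x : ℝ in (-R)..R, g (x + R * Complex.I)‖ ≤ C * (R ^ (-a) * R⁻¹) * |R - -R| := by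
    refine intervalIntegral.norm_integral_le_of_norm_le_const fun x _ => key _ ?_ ?_
    · rw [im_ofReal_add_mul_I]; exact hR0.le
    · have := Complex.abs_im_le_norm ((x : ℂ) + R * Complex.I)
      rwa [im_ofReal_add_mul_I, abs_of_pos hR0] at this
  have b2 : ∀ c : ℝ, |c| = R →
      ‖∫ y : ℝ in (0 : ℝ)..R, g ((c : ℂ) + y * Complex.I)‖ ≤ C * (R ^ (-a) * R⁻¹) * |R - 0| := by
    intro c hc
    refine intervalIntegral.norm_integral_le_of_norm_le_const fun y hy => key _ ?_ ?_
    · rw [uIoc_of_le hR0.le] at hy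
      rw [im_ofReal_add_mul_I]; exact hy.1.le
    · have := Complex.abs_re_le_norm ((c : ℂ) + y * Complex.I)
      simpa [hc] using this
  have b3 := b2 R (abs_of_pos hR0)
  have b4 := b2 (-R) (by rw [abs_neg, abs_of_pos hR0])
  push_cast at b4
  have e : ∫ x : ℝ in (-R)..R, g x = (∫ x : ℝ in (-R)..R, g (x + R * Complex.I)) -
      Complex.I * (∫ y : ℝ in (0 : ℝ)..R, g ((R : ℂ) + y * Complex.I)) +
      Complex.I * (∫ y : ℝ in (0 : ℝ)..R, g (-(R : ℂ) + y * Complex.I)) := by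
    linear_combination hrect
  rw [e]
  refine (norm_add_le _ _).trans ((add_le_add_left (norm_sub_le _ _) _).trans ?_)
  rw [norm_mul, norm_mul, Complex.norm_I, one_mul, one_mul]
  have e1 : |R - -R| = 2 * R := by rw [abs_of_pos (by linarith)]; ring
  have e2 : |R - 0| = R := by rw [sub_zero, abs_of_pos hR0]
  rw [e1] at b1
  rw [e2] at b3 b4
  have e3 : C * (R ^ (-a) * R⁻¹) * R = C * R ^ (-a) := by field_simp
  linarith

/-- The integrand `(v + i)^(-a) (v - w)⁻¹` has its singularities strictly below the real axis. For
`Im v ≥ 0` and `|v| ≥ R ≥ 2|w| + 1` one has `|v + i| ≥ R` and `|v - w| ≥ R/2`, which gives the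
constant `2`. -/
theorem cauchyTransform_shiftedPower {p : ℝ≥0∞} (hp₁ : 1 < p) (hp₂ : p < ∞) {a : ℝ} (ha₀ : 0 < a)
    (ha : 1 < a * p.toReal) {z : ℂ} (hz : 0 < z.im) :
    cauchyTransform (shiftedPower a 1) (starRingEnd ℂ z) = 0 := by
  set w := starRingEnd ℂ z with hw
  have hwim : w.im < 0 := by simpa [hw] using hz
  have hint := integrable_mul_inv_ofReal_sub hp₁ hp₂ (memLp_shiftedPower hp₁.le hp₂ ha) hwim.ne
  refine integral_eq_zero_of_norm_le
    (g := fun v : ℂ => (v + (1 : ℝ) * Complex.I) ^ ((-a : ℝ) : ℂ) * (v - w)⁻¹)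
    (a := a) (C := 2) (R₀ := 2 * ‖w‖ + 1) ?_ ha₀ ?_ hint
  · intro v hv
    have h1 : v + (1 : ℝ) * Complex.I ∈ Complex.slitPlane :=
      mem_slitPlane_of_im_pos (by simp; linarith)
    have h2 : v - w ≠ 0 := by
      intro h
      have := congrArg Complex.im h
      simp at this
      linarith
    refine DifferentiableAt.mul ?_ ((differentiableAt_id.sub_const w).inv h2)
    exact (differentiableAt_id.add_const _).cpow_const h1
  · intro R hR v hv hvR
    have hR0 : 0 < R := by linarith [norm_nonneg w]
    have h1 : R ≤ ‖v + (1 : ℝ) * Complex.I‖ := by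
      refine hvR.trans (Real.sqrt_le_sqrt ?_)
      rw [Complex.normSq_apply, Complex.normSq_apply]
      simp
      nlinarith
    have h2 : R / 2 ≤ ‖v - w‖ := by
      have := norm_sub_norm_le v w
      linarith
    rw [norm_mul, norm_inv, Complex.norm_cpow_real]
    have h3 : ‖v + (1 : ℝ) * Complex.I‖ ^ (-a) ≤ R ^ (-a) :=
      Real.rpow_le_rpow_of_nonpos hR0 h1 (by linarith)
    have h4 : ‖v - w‖⁻¹ ≤ (R / 2)⁻¹ := by gcongr
    calc _ ≤ R ^ (-a) * (R / 2)⁻¹ := by gcongr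
      _ = _ := by rw [inv_div]; field_simp

/-- Mean value inequality in the height `τ ≥ m = min t 1`, using `|x + iτ| ≥ m |x + i|`. The
exponent `-(a+1)` is relaxed to `-3` on `m ≤ 1` and to `-1` on `|x + i| ≥ 1`, so that the bound is
uniform in `a`. -/
theorem norm_shiftedPower_sub_le {a : ℝ} (ha₀ : 0 < a) (ha : a ≤ 2) {t : ℝ} (ht : 0 < t) (x : ℝ) :
    ‖shiftedPower a t x - shiftedPower a 1 x‖ ≤
      2 * min t 1 ^ (-3 : ℝ) * |t - 1| * ‖shiftedPower 1 1 x‖ := by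
  set m := min t 1 with hm
  have hm0 : 0 < m := lt_min ht one_pos
  have hm1 : m ≤ 1 := min_le_right _ _
  have hder : ∀ τ ∈ Ici m, HasDerivWithinAt (fun τ : ℝ => shiftedPower a τ x)
      (((-a : ℝ) : ℂ) * ((x : ℂ) + τ * Complex.I) ^ (((-a : ℝ) : ℂ) - 1) * Complex.I)
      (Ici m) τ := by
    intro τ hτ
    have hτ' : 0 < τ := hm0.trans_le hτ
    have h1 : HasDerivAt (fun τ : ℝ => (x : ℂ) + τ * Complex.I) Complex.I τ := by
      simpa using ((Complex.ofRealCLM.hasDerivAt (x := τ)).mul_const Complex.I).const_add (x : ℂ)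
    have h2 : HasDerivAt (fun v : ℂ => v ^ ((-a : ℝ) : ℂ))
        (((-a : ℝ) : ℂ) * ((x : ℂ) + τ * Complex.I) ^ (((-a : ℝ) : ℂ) - 1))
        ((x : ℂ) + τ * Complex.I) := by
      simpa using (hasDerivAt_id ((x : ℂ) + τ * Complex.I)).cpow_const (c := ((-a : ℝ) : ℂ))
        (mem_slitPlane_of_im_pos (by simpa using hτ'))
    exact (h2.comp τ h1).hasDerivWithinAt
  refine (Convex.norm_image_sub_le_of_norm_hasDerivWithin_le
    (C := 2 * m ^ (-3 : ℝ) * ‖shiftedPower 1 1 x‖) hder ?_ (convex_Ici m) (min_le_right t 1)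
    (min_le_left t 1)).trans (le_of_eq ?_)
  · intro τ hτ
    have hτ' : m ≤ τ := hτ
    have hx : 0 < √(x ^ 2 + 1 ^ 2) := Real.sqrt_pos.2 (by positivity)
    have hx1 : 1 ≤ √(x ^ 2 + 1 ^ 2) := Real.le_sqrt_of_sq_le (by nlinarith [sq_nonneg x])
    have e : (((-a : ℝ) : ℂ) - 1) = ((-(a + 1) : ℝ) : ℂ) := by push_cast; ring
    have hle : m * √(x ^ 2 + 1 ^ 2) ≤ √(x ^ 2 + τ ^ 2) := by
      refine Real.le_sqrt_of_sq_le ?_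
      rw [mul_pow, Real.sq_sqrt (by positivity)]
      have : m ^ 2 ≤ τ ^ 2 := by gcongr
      have : m ^ 2 ≤ 1 := by nlinarith
      nlinarith [sq_nonneg x]
    rw [norm_mul, norm_mul, Complex.norm_I, mul_one, e, Complex.norm_cpow_real,
      norm_ofReal_add_mul_I, Complex.norm_real, Real.norm_eq_abs, abs_neg, abs_of_pos ha₀,
      norm_shiftedPower, mul_assoc]
    gcongr
    calc √(x ^ 2 + τ ^ 2) ^ (-(a + 1)) ≤ (m * √(x ^ 2 + 1 ^ 2)) ^ (-(a + 1)) :=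
          Real.rpow_le_rpow_of_nonpos (by positivity) hle (by linarith)
      _ = m ^ (-(a + 1)) * √(x ^ 2 + 1 ^ 2) ^ (-(a + 1)) :=
          Real.mul_rpow hm0.le hx.le
      _ ≤ m ^ (-3 : ℝ) * √(x ^ 2 + 1 ^ 2) ^ (-1 : ℝ) := by
          gcongr ?_ * ?_
          · exact Real.rpow_le_rpow_of_exponent_ge hm0 hm1 (by linarith)
          · exact Real.rpow_le_rpow_of_exponent_le hx1 (by linarith)
  · rw [Real.norm_eq_abs]; ring

/-- Of the two terms, the first has a coefficient vanishing as `a → 1/p`; the second does not depend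
on `a` and becomes negligible against the growing norm of `shiftedPower a 1`. -/
theorem eLpNorm_dilation_shiftedPower_sub_le {p : ℝ≥0∞} (hp₁ : 1 ≤ p) (hp₂ : p < ∞) {a : ℝ}
    (ha₀ : 0 < a) (ha : a ≤ 2) {t : ℝ} (ht : 0 < t) :
    eLpNorm (fun x => dilation p.toReal t (shiftedPower a 1) x - shiftedPower a 1 x) p volume ≤
      ENNReal.ofReal |1 - t ^ (-(a - 1 / p.toReal))| * eLpNorm (shiftedPower a 1) p volume +
      ENNReal.ofReal (2 * min t 1 ^ (-3 : ℝ) * |t - 1|) *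
        eLpNorm (shiftedPower 1 1) p volume := by
  have hc : t ^ (-(a - 1 / p.toReal)) * t ^ (a - 1 / p.toReal) = 1 := by
    rw [← Real.rpow_add ht, neg_add_cancel, Real.rpow_zero]
  have hcm : Continuous (shiftedPower a 1) := continuous_shiftedPower a one_pos
  have hct : Continuous (shiftedPower a t) := continuous_shiftedPower a ht
  have hcd : AEStronglyMeasurable (dilation p.toReal t (shiftedPower a 1)) := by
    refine Continuous.aestronglyMeasurable ?_
    unfold dilation
    fun_prop
  have e : (fun x => dilation p.toReal t (shiftedPower a 1) x - shiftedPower a 1 x) =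
      (((1 - t ^ (-(a - 1 / p.toReal)) : ℝ) : ℂ) • dilation p.toReal t (shiftedPower a 1)) +
        fun x => shiftedPower a t x - shiftedPower a 1 x := by
    funext x
    have h1 : shiftedPower a t x = ((t ^ (-(a - 1 / p.toReal)) : ℝ) : ℂ) *
        dilation p.toReal t (shiftedPower a 1) x := by
      rw [dilation_shiftedPower _ _ _ ht, ← mul_assoc, ← Complex.ofReal_mul, hc,
        Complex.ofReal_one, one_mul]
    simp only [Pi.add_apply, Pi.smul_apply, smul_eq_mul]
    rw [h1]
    push_cast
    ring
  rw [e]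
  refine (eLpNorm_add_le (hcd.const_smul _) (hct.sub hcm).aestronglyMeasurable hp₁).trans ?_
  rw [eLpNorm_const_smul, eLpNorm_dilation hp₁ hp₂ _ ht]
  gcongr ?_ + ?_
  · rw [← ofReal_norm, Complex.norm_real, Real.norm_eq_abs]
  · have h0 : 0 ≤ 2 * min t 1 ^ (-3 : ℝ) * |t - 1| := by
      have : 0 < min t 1 := lt_min ht one_pos
      positivity
    calc eLpNorm (fun x => shiftedPower a t x - shiftedPower a 1 x) p volume
        ≤ eLpNorm ((2 * min t 1 ^ (-3 : ℝ) * |t - 1|) • shiftedPower 1 1) p volume := by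
          refine eLpNorm_mono_ae (Eventually.of_forall fun x => ?_)
          rw [Pi.smul_apply, norm_smul, Real.norm_of_nonneg h0]
          exact norm_shiftedPower_sub_le ha₀ ha ht x
      _ = _ := by rw [eLpNorm_const_smul, Real.enorm_of_nonneg h0]

/-- The norms of the functions `(x + i)^(-a)` blow up as `a` decreases to `1 / p`. -/
theorem tendsto_eLpNorm_shiftedPower {p : ℝ≥0∞} (hp₁ : 1 ≤ p) (hp₂ : p < ∞) :
    Tendsto (fun a => eLpNorm (shiftedPower a 1) p volume) (𝓝[>] (1 / p.toReal)) (𝓝 ∞) := by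
  have hp : 0 < p.toReal := ENNReal.toReal_pos (by positivity) hp₂.ne
  -- Keep only `x > 1`, where `|x + i| ≤ 2x`, and integrate `(2x)^(-ap)`.
  have hlow : ∀ a : ℝ, 1 / p.toReal < a →
      ENNReal.ofReal (2 ^ (-(a * p.toReal)) * (a * p.toReal - 1)⁻¹) ≤
        eLpNorm (shiftedPower a 1) p volume ^ p.toReal := by
    intro a ha
    have ha' : 1 < a * p.toReal := (div_lt_iff₀ hp).1 ha
    have ha0 : 0 < a := (by positivity : (0 : ℝ) < 1 / p.toReal).trans ha
    rw [eLpNorm_rpow_toReal hp₁ hp₂]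
    refine le_trans ?_ (setLIntegral_le_lintegral (Ioi 1) _)
    have h1 := integral_Ioi_rpow_of_lt (a := -(a * p.toReal)) (by linarith) one_pos
    have h2 : (a * p.toReal - 1)⁻¹ = ∫ t : ℝ in Ioi 1, t ^ (-(a * p.toReal)) := by
      rw [h1, Real.one_rpow, inv_eq_one_div, ← neg_div_neg_eq]
      ring_nf
    rw [h2, ← integral_const_mul, ofReal_integral_eq_lintegral_ofReal
      ((integrableOn_Ioi_rpow_of_lt (by linarith) one_pos).const_mul _)]
    · refine setLIntegral_mono' measurableSet_Ioi fun x hx => ?_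
      have hx1 : 1 < x := hx
      rw [← ofReal_norm, ENNReal.ofReal_rpow_of_nonneg (norm_nonneg _) hp.le, norm_shiftedPower,
        ← Real.rpow_mul (by positivity), ← Real.mul_rpow (by norm_num) (by linarith), neg_mul]
      apply ENNReal.ofReal_le_ofReal
      refine Real.rpow_le_rpow_of_nonpos (Real.sqrt_pos.2 (by positivity)) ?_ (by linarith)
      rw [Real.sqrt_le_left (by linarith)]
      nlinarith
    · filter_upwards [ae_restrict_mem measurableSet_Ioi] with x hx
      have hx1 : (1 : ℝ) < x := hx
      simp only [Pi.zero_apply]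
      positivity
  have hlim : Tendsto (fun a : ℝ => 2 ^ (-(a * p.toReal)) * (a * p.toReal - 1)⁻¹)
      (𝓝[>] (1 / p.toReal)) atTop := by
    have h1 : Tendsto (fun a : ℝ => (2 : ℝ) ^ (-(a * p.toReal))) (𝓝[>] (1 / p.toReal))
        (𝓝 (2 ^ (-(1 / p.toReal * p.toReal)))) := by
      refine Tendsto.mono_left ?_ nhdsWithin_le_nhds
      refine Continuous.tendsto ?_ _
      exact Continuous.rpow continuous_const (by fun_prop) fun _ => Or.inl (by norm_num)
    refine h1.pos_mul_atTop (by positivity) (tendsto_inv_nhdsGT_zero.comp ?_)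
    refine tendsto_nhdsWithin_iff.2 ⟨?_, ?_⟩
    · have : Tendsto (fun a : ℝ => a * p.toReal - 1) (𝓝 (1 / p.toReal))
          (𝓝 (1 / p.toReal * p.toReal - 1)) := Continuous.tendsto (by fun_prop) _
      rw [one_div_mul_cancel hp.ne', sub_self] at this
      exact this.mono_left nhdsWithin_le_nhds
    · filter_upwards [self_mem_nhdsWithin] with a ha
      have ha' : 1 < a * p.toReal := (div_lt_iff₀ hp).1 ha
      exact mem_Ioi.2 (by linarith)
  have h3 : Tendsto (fun a => eLpNorm (shiftedPower a 1) p volume ^ p.toReal)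
      (𝓝[>] (1 / p.toReal)) (𝓝 ∞) := by
    refine tendsto_nhds_top_mono (ENNReal.tendsto_ofReal_atTop.comp hlim) ?_
    filter_upwards [self_mem_nhdsWithin] with a ha
    exact hlow a ha
  have h4 := h3.ennrpow_const (1 / p.toReal)
  rw [ENNReal.top_rpow_of_pos (by positivity)] at h4
  refine h4.congr fun a => ?_
  rw [← ENNReal.rpow_mul, mul_one_div_cancel hp.ne', ENNReal.rpow_one]

theorem measurable_eLpNorm_of_uncurry {p : ℝ≥0∞} (hp₁ : 1 ≤ p) (hp₂ : p < ∞) {F : ℝ → ℝ → ℂ}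
    (hF : Measurable (Function.uncurry F)) : Measurable fun t => eLpNorm (F t) p volume := by
  have hp : 0 < p.toReal := ENNReal.toReal_pos (by positivity) hp₂.ne
  simp_rw [eLpNorm_eq_lintegral_rpow_enorm_toReal (by positivity : p ≠ 0) hp₂.ne]
  have : Measurable (Function.uncurry fun t x => ‖F t x‖ₑ ^ p.toReal) := hF.enorm.pow_const _
  exact this.lintegral_prod_right'.pow_const _

/-! ### The lower bound for the norm -/

/-- If the Hardy space contains vectors that are asymptotically invariant under dilations, then the
norm of an average of dilations is the mass of the averaging measure. -/
theorem measure_univ_le_norm_dilationAverageCLM {ν : Measure ℝ} [IsFiniteMeasure ν] {p : ℝ≥0∞}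
    [Fact (1 ≤ p)] (hν : ∀ᵐ t ∂ν, 0 < t) (hp₁ : 1 < p) (hp₂ : p < ∞) {F : ℕ → ℝ → ℂ}
    (hFm : ∀ n, Measurable (F n)) (hF : ∀ n, MemLp (F n) p)
    (hF₀ : ∀ n, eLpNorm (F n) p volume ≠ 0)
    (hC : ∀ n, ∀ z : ℂ, 0 < z.im → cauchyTransform (F n) (starRingEnd ℂ z) = 0)
    (hinv : ∀ t, 0 < t → Tendsto (fun n =>
      eLpNorm (fun x => dilation p.toReal t (F n) x - F n x) p volume / eLpNorm (F n) p volume)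
      atTop (𝓝 0)) :
    (ν univ).toReal ≤ ‖dilationAverageCLM hν hp₁ hp₂‖ := by
  have hp : 0 < p.toReal := ENNReal.toReal_pos (by positivity) hp₂.ne
  have hr : 1 < p.toReal := one_lt_toReal hp₁ hp₂
  set T := dilationAverageCLM hν hp₁ hp₂
  set W := (ν univ).toReal
  set N : ℕ → ℝ≥0∞ := fun n => eLpNorm (F n) p volume
  have hN : ∀ n, N n ≠ ∞ := fun n => (hF n).2.ne
  set q : ℕ → ℝ → ℝ≥0∞ := fun n t =>
    eLpNorm (fun x => dilation p.toReal t (F n) x - F n x) p volume / N n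
  have hDm : ∀ n, Measurable (Function.uncurry fun t x => dilation p.toReal t (F n) x - F n x) :=
    fun n => (measurable_uncurry_dilation p.toReal (hFm n)).sub ((hFm n).comp measurable_snd)
  have hqN : ∀ n t, eLpNorm (fun x => dilation p.toReal t (F n) x - F n x) p volume =
      q n t * N n := fun n t => (ENNReal.div_mul_cancel (hF₀ n) (hN n)).symm
  -- Dilations are isometries, so the relative defect is at most `2`; on the finite measure `ν` this
  -- constant is the majorant for dominated convergence.
  have hq2 : ∀ n, ∀ t, 0 < t → q n t ≤ 2 := by
    intro n t ht
    refine ENNReal.div_le_of_le_mul ?_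
    have h1 : AEStronglyMeasurable (dilation p.toReal t (F n)) :=
      ((measurable_uncurry_dilation p.toReal (hFm n)).comp
        measurable_prodMk_left).aestronglyMeasurable
    refine (eLpNorm_sub_le h1 (hF n).1 hp₁.le).trans ?_
    rw [eLpNorm_dilation hp₁.le hp₂ _ ht, two_mul]
  have hint : Tendsto (fun n => ∫⁻ t, q n t ^ p.toReal ∂ν) atTop (𝓝 0) := by
    have : (0 : ℝ≥0∞) = ∫⁻ _, 0 ∂ν := by simp
    rw [this]
    refine tendsto_lintegral_of_dominated_convergence (fun _ => 2 ^ p.toReal) ?_ ?_ ?_ ?_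
    · intro n
      exact ((measurable_eLpNorm_of_uncurry hp₁.le hp₂ (hDm n)).div_const _).pow_const _
    · intro n
      filter_upwards [hν] with t ht
      gcongr
      exact hq2 n t ht
    · rw [lintegral_const]
      exact ENNReal.mul_ne_top (ENNReal.rpow_ne_top_of_nonneg hp.le (by simp)) (measure_ne_top _ _)
    · filter_upwards [hν] with t ht
      have := (hinv t ht).ennrpow_const p.toReal
      rwa [ENNReal.zero_rpow_of_pos hp] at this
  -- The Jensen bound for `‖T G - W G‖ / ‖G‖`, where `G` is the class of `F n`.
  set ρ : ℕ → ℝ≥0∞ := fun n =>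
    (ν univ ^ (p.toReal - 1) * ∫⁻ t, q n t ^ p.toReal ∂ν) ^ (1 / p.toReal)
  have hρ : Tendsto ρ atTop (𝓝 0) := by
    have h1 := ENNReal.Tendsto.const_mul (a := ν univ ^ (p.toReal - 1)) hint
      (Or.inr (ENNReal.rpow_ne_top_of_nonneg (by linarith) (measure_ne_top _ _)))
    rw [mul_zero] at h1
    have h2 := h1.ennrpow_const (1 / p.toReal)
    rwa [ENNReal.zero_rpow_of_pos (by positivity)] at h2
  have hest : ∀ n, ρ n ≠ ∞ → W ≤ ‖T‖ + (ρ n).toReal := by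
    intro n hρn
    have hmem : (hF n).toLp (F n) ∈ HardyPlus p := by
      rw [mem_hardyPlus_iff hp₁ hp₂]
      intro z hz
      rw [cauchyTransform_congr_ae (MemLp.coeFn_toLp _)]
      exact hC n z hz
    set G : HardyPlus p := ⟨(hF n).toLp (F n), hmem⟩
    have hGF : (G : Lp ℂ p (volume : Measure ℝ)) =ᵐ[volume] F n := MemLp.coeFn_toLp (hF n)
    have hGnorm : ‖G‖ = (N n).toReal := Lp.norm_toLp _ (hF n)
    have hGpos : 0 < ‖G‖ := by
      rw [hGnorm]; exact ENNReal.toReal_pos (hF₀ n) (hN n)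
    have hdiff : eLpNorm ((T G - (W : ℂ) • G : HardyPlus p) : Lp ℂ p (volume : Measure ℝ)) p
        volume ≤ ρ n * N n := by
      have h1 : ((T G - (W : ℂ) • G : HardyPlus p) : Lp ℂ p (volume : Measure ℝ)) =ᵐ[volume]
          fun x => ∫ t, (dilation p.toReal t (F n) x - F n x) ∂ν := by
        refine (Lp.coeFn_sub (T G).1 ((W : ℂ) • G).1).trans ?_
        filter_upwards [coeFn_dilationAverageCLM hν hp₁ hp₂ G,
          dilationAverage_congr_ae hν p.toReal (measurable_coe_Lp G.1) (hFm n) hGF,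
          Lp.coeFn_smul (W : ℂ) G.1, hGF,
          ae_integrable_dilation hν hp₁ hp₂ (hFm n) (hF n)] with x h1 h2 h3 h4 h5
        rw [integral_sub h5 (integrable_const _), integral_const, Pi.sub_apply]
        change (T G : Lp ℂ p (volume : Measure ℝ)) x -
          ((W : ℂ) • (G : Lp ℂ p (volume : Measure ℝ)) : Lp ℂ p (volume : Measure ℝ)) x = _
        rw [h1, h2, h3, Pi.smul_apply, h4, Complex.real_smul, smul_eq_mul]
        rfl
      rw [eLpNorm_congr_ae h1, ← ENNReal.rpow_le_rpow_iff hp]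
      refine (eLpNorm_integral_rpow_le hp₁ hp₂ (hDm n)).trans (le_of_eq ?_)
      simp_rw [hqN n, ENNReal.mul_rpow_of_nonneg _ _ hp.le]
      rw [lintegral_mul_const' _ _ (ENNReal.rpow_ne_top_of_nonneg hp.le (hN n)),
        ← ENNReal.rpow_mul, one_div_mul_cancel hp.ne', ENNReal.rpow_one, mul_assoc]
    have hdiff' : ‖T G - (W : ℂ) • G‖ ≤ (ρ n).toReal * ‖G‖ := by
      rw [hGnorm, ← ENNReal.toReal_mul]
      change ‖((T G - (W : ℂ) • G : HardyPlus p) : Lp ℂ p (volume : Measure ℝ))‖ ≤ _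
      rw [Lp.norm_def]
      exact ENNReal.toReal_mono (ENNReal.mul_ne_top hρn (hN n)) hdiff
    have h1 : W * ‖G‖ ≤ ‖T G‖ + ‖T G - (W : ℂ) • G‖ := by
      have h2 : ‖(W : ℂ) • G‖ = W * ‖G‖ := by
        rw [norm_smul, Complex.norm_real, Real.norm_of_nonneg ENNReal.toReal_nonneg]
      rw [← h2]
      have := norm_sub_le (T G) (T G - (W : ℂ) • G)
      rwa [sub_sub_cancel] at this
    have h2 := T.le_opNorm G
    refine le_of_mul_le_mul_right ?_ hGpos
    rw [add_mul]
    linarith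
  have hρ' : Tendsto (fun n => ‖T‖ + (ρ n).toReal) atTop (𝓝 ‖T‖) := by
    simpa using ((ENNReal.tendsto_toReal ENNReal.zero_ne_top).comp hρ).const_add ‖T‖
  refine ge_of_tendsto hρ' ?_
  filter_upwards [hρ.eventually (gt_mem_nhds one_pos)] with n hn
  exact hest n (hn.trans ENNReal.one_lt_top).ne

theorem norm_dilationAverageCLM {ν : Measure ℝ} [IsFiniteMeasure ν] {p : ℝ≥0∞}
    [Fact (1 ≤ p)] (hν : ∀ᵐ t ∂ν, 0 < t) (hp₁ : 1 < p) (hp₂ : p < ∞) :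
    ‖dilationAverageCLM hν hp₁ hp₂‖ = (ν univ).toReal := by
  refine le_antisymm (norm_dilationAverageCLM_le hν hp₁ hp₂) ?_
  have hp : 0 < p.toReal := ENNReal.toReal_pos (by positivity) hp₂.ne
  have hr : 1 < p.toReal := one_lt_toReal hp₁ hp₂
  -- Decreases to `1/p` while staying at most `2`, the range in which the difference estimate is
  -- uniform.
  set a : ℕ → ℝ := fun n => 1 / p.toReal + 1 / ((n : ℝ) + 1) with ha
  have hε : ∀ n : ℕ, (0 : ℝ) < 1 / ((n : ℝ) + 1) := fun n => by positivity
  have ha0 : ∀ n, 0 < a n := fun n => by have := hε n; positivity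
  have ha1 : ∀ n, 1 < a n * p.toReal := fun n => by
    rw [← div_lt_iff₀ hp]; have := hε n; simp only [ha]; linarith
  have ha2 : ∀ n, a n ≤ 2 := fun n => by
    have h1 : 1 / p.toReal ≤ 1 := by rw [div_le_one hp]; exact hr.le
    have h2 : 1 / ((n : ℝ) + 1) ≤ 1 := by
      rw [div_le_one (by positivity)]; linarith [(Nat.cast_nonneg n : (0 : ℝ) ≤ n)]
    simp only [ha]; linarith
  have hmem : ∀ n, MemLp (shiftedPower (a n) 1) p := fun n => memLp_shiftedPower hp₁.le hp₂ (ha1 n)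
  have hεlim : Tendsto (fun n : ℕ => 1 / ((n : ℝ) + 1)) atTop (𝓝 0) :=
    tendsto_one_div_add_atTop_nhds_zero_nat
  have halim : Tendsto a atTop (𝓝[>] (1 / p.toReal)) := by
    refine tendsto_nhdsWithin_iff.2 ⟨by simpa [ha] using hεlim.const_add (1 / p.toReal), ?_⟩
    exact Eventually.of_forall fun n => mem_Ioi.2 (by have := hε n; simp only [ha]; linarith)
  have hNlim := (tendsto_eLpNorm_shiftedPower hp₁.le hp₂).comp halim
  have hN0 : ∀ n, eLpNorm (shiftedPower (a n) 1) p volume ≠ 0 := by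
    intro n h
    rw [eLpNorm_eq_zero_iff (hmem n).1 (by positivity)] at h
    obtain ⟨x, hx⟩ := h.exists
    have h1 := norm_shiftedPower (a n) 1 x
    rw [hx, Pi.zero_apply, norm_zero] at h1
    have : 0 < √(x ^ 2 + 1 ^ 2) ^ (-(a n)) :=
      Real.rpow_pos_of_pos (Real.sqrt_pos.2 (by positivity)) _
    linarith
  refine measure_univ_le_norm_dilationAverageCLM hν hp₁ hp₂
    (F := fun n => shiftedPower (a n) 1)
    (fun n => (continuous_shiftedPower (a n) one_pos).measurable) hmem hN0
    (fun n z hz => cauchyTransform_shiftedPower hp₁ hp₂ (ha0 n) (ha1 n) hz) ?_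
  intro t ht
  -- Independent of `n`, and finite because `1 < p` puts `(x + i)⁻¹` in `L^p`.
  set M := ENNReal.ofReal (2 * min t 1 ^ (-3 : ℝ) * |t - 1|) * eLpNorm (shiftedPower 1 1) p volume
  have hM : M ≠ ∞ := ENNReal.mul_ne_top ENNReal.ofReal_ne_top
    (memLp_shiftedPower hp₁.le hp₂ (by simpa using hr)).2.ne
  have hup : Tendsto (fun n => ENNReal.ofReal |1 - t ^ (-(a n - 1 / p.toReal))| +
      M / eLpNorm (shiftedPower (a n) 1) p volume) atTop (𝓝 (0 + 0)) := by
    refine Tendsto.add ?_ ?_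
    · have h1 : Tendsto (fun n => |1 - t ^ (-(a n - 1 / p.toReal))|) atTop
          (𝓝 |1 - t ^ (-(0 : ℝ))|) := by
        refine (tendsto_const_nhds.sub ?_).abs
        have : (fun n => t ^ (-(a n - 1 / p.toReal))) =
            fun n : ℕ => t ^ (-(1 / ((n : ℝ) + 1))) := by
          funext n; simp only [ha]; ring_nf
        rw [this]
        exact tendsto_const_nhds.rpow hεlim.neg (Or.inl ht.ne')
      have h2 := ENNReal.tendsto_ofReal h1
      simpa using h2
    · have := ENNReal.Tendsto.const_div (a := M) hNlim (Or.inr hM)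
      simpa using this
  rw [add_zero] at hup
  refine tendsto_of_tendsto_of_tendsto_of_le_of_le tendsto_const_nhds hup
    (fun _ => zero_le) fun n => ?_
  refine ENNReal.div_le_of_le_mul ?_
  rw [add_mul, ENNReal.div_mul_cancel (hN0 n) (hmem n).2.ne]
  exact eLpNorm_dilation_shiftedPower_sub_le hp₁.le hp₂ (ha0 n) (ha2 n) ht

/-! ### The Hausdorff operator as an average of dilations -/

/-- The measure `t^(1/r - 1) φ(t) dt` on the half-line. -/
def weightMeasure (r : ℝ) (φ : ℝ → ℝ) : Measure ℝ :=
  (volume.restrict (Ioi 0)).withDensity fun t => ENNReal.ofReal (t ^ (1 / r - 1) * φ t)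

theorem ae_weightMeasure_pos (r : ℝ) (φ : ℝ → ℝ) : ∀ᵐ t ∂(weightMeasure r φ), 0 < t :=
  (withDensity_absolutelyContinuous _ _).ae_le (ae_restrict_mem measurableSet_Ioi)

section Weight

variable {r : ℝ} {φ : ℝ → ℝ}

theorem aemeasurable_weight {w : ℝ → ℝ} (hw : IntegrableOn w (Ioi 0)) :
    AEMeasurable (fun t => ENNReal.ofReal (w t)) (volume.restrict (Ioi 0)) :=
  hw.aestronglyMeasurable.aemeasurable.ennreal_ofReal

theorem isFiniteMeasure_weightMeasure
    (hφ : IntegrableOn (fun t : ℝ => t ^ (1 / r - 1) * φ t) (Ioi 0)) :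
    IsFiniteMeasure (weightMeasure r φ) :=
  isFiniteMeasure_withDensity hφ.lintegral_lt_top.ne

theorem toReal_weightMeasure_univ (hφ₀ : ∀ᵐ t ∂(volume.restrict (Ioi (0 : ℝ))), 0 ≤ φ t)
    (hφ : IntegrableOn (fun t : ℝ => t ^ (1 / r - 1) * φ t) (Ioi 0)) :
    (weightMeasure r φ univ).toReal = ∫ t in Ioi (0 : ℝ), t ^ (1 / r - 1) * φ t := by
  rw [weightMeasure, withDensity_apply _ MeasurableSet.univ, Measure.restrict_univ,
    integral_eq_lintegral_of_nonneg_ae _ hφ.aestronglyMeasurable]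
  filter_upwards [hφ₀, ae_restrict_mem measurableSet_Ioi] with t ht ht0
  have : (0 : ℝ) < t := ht0
  simp only [Pi.zero_apply]
  positivity

/-- The powers of `t` in the weight and in the normalization multiply to `t⁻¹`. -/
theorem weight_smul_dilation_ae_eq
    (hφ₀ : ∀ᵐ t ∂(volume.restrict (Ioi (0 : ℝ))), 0 ≤ φ t) (f : ℝ → ℂ) (x : ℝ) :
    (fun t => (ENNReal.ofReal (t ^ (1 / r - 1) * φ t)).toReal • dilation r t f x)
      =ᵐ[volume.restrict (Ioi 0)] fun t => f (x / t) * ((φ t / t : ℝ) : ℂ) := by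
  filter_upwards [hφ₀, ae_restrict_mem measurableSet_Ioi] with t ht ht0
  have ht1 : (0 : ℝ) < t := ht0
  have h : t ^ (1 / r - 1) * t ^ (-(1 / r)) = t⁻¹ := by
    rw [← Real.rpow_add ht1, ← Real.rpow_neg_one]; ring_nf
  rw [ENNReal.toReal_ofReal (by positivity), Complex.real_smul, dilation, ← mul_assoc,
    ← Complex.ofReal_mul, mul_right_comm, h, mul_comm, inv_mul_eq_div]

theorem dilationAverage_weightMeasure (hφ₀ : ∀ᵐ t ∂(volume.restrict (Ioi (0 : ℝ))), 0 ≤ φ t)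
    (hφ : IntegrableOn (fun t : ℝ => t ^ (1 / r - 1) * φ t) (Ioi 0)) (f : ℝ → ℂ) :
    dilationAverage (weightMeasure r φ) r f = hausdorffOp φ f := by
  funext x
  unfold dilationAverage hausdorffOp weightMeasure
  rw [integral_withDensity_eq_integral_toReal_smul₀ (aemeasurable_weight hφ)
    (Eventually.of_forall fun _ => ENNReal.ofReal_lt_top)]
  exact integral_congr_ae (weight_smul_dilation_ae_eq hφ₀ f x)

theorem integrable_dilation_weightMeasure_iff
    (hφ₀ : ∀ᵐ t ∂(volume.restrict (Ioi (0 : ℝ))), 0 ≤ φ t)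
    (hφ : IntegrableOn (fun t : ℝ => t ^ (1 / r - 1) * φ t) (Ioi 0)) (f : ℝ → ℂ) (x : ℝ) :
    Integrable (fun t => dilation r t f x) (weightMeasure r φ) ↔
      IntegrableOn (fun t => f (x / t) * ((φ t / t : ℝ) : ℂ)) (Ioi 0) := by
  unfold weightMeasure
  rw [integrable_withDensity_iff_integrable_smul₀' (aemeasurable_weight hφ)
    (Eventually.of_forall fun _ => ENNReal.ofReal_lt_top)]
  exact integrable_congr (weight_smul_dilation_ae_eq hφ₀ f x)

end Weight

end HausdorffHardy

end

theorem theorem3p2 (p : ℝ≥0∞) [Fact (1 ≤ p)] (hp₁ : 1 < p) (hp₂ : p < ∞)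
    (φ : ℝ → ℝ) (hφ : LocallyIntegrableOn φ (Ioi 0))
    (hφ₀ : ∀ᵐ t ∂(volume.restrict (Ioi (0 : ℝ))), 0 ≤ φ t)
    (hφp : IntegrableOn (fun t : ℝ => t ^ (1 / p.toReal - 1) * φ t) (Ioi 0)) :
    (∀ f : HausdorffHardy.HardyPlus p, ∀ᵐ x : ℝ,
      IntegrableOn (fun t : ℝ => (f : Lp ℂ p (volume : Measure ℝ)) (x / t) * ((φ t / t : ℝ) : ℂ))
        (Ioi 0)) ∧
    ∃ T : HausdorffHardy.HardyPlus p →L[ℂ] HausdorffHardy.HardyPlus p,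
      (∀ f : HausdorffHardy.HardyPlus p,
        ((T f : Lp ℂ p (volume : Measure ℝ)) : ℝ → ℂ) =ᵐ[volume]
          HausdorffHardy.hausdorffOp φ (f : Lp ℂ p (volume : Measure ℝ))) ∧
      ‖T‖ = (∫ t in Ioi (0 : ℝ), t ^ (1 / p.toReal - 1) * φ t) ∧
      ∃ S : HausdorffHardy.HardyPlus p →L[ℂ] HausdorffHardy.HardyPlus p,
        (∀ f : HausdorffHardy.HardyPlus p,
          HausdorffHardy.IsHilbertTransform (f : Lp ℂ p (volume : Measure ℝ))
            (S f : Lp ℂ p (volume : Measure ℝ))) ∧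
        T ∘L S = S ∘L T := by
  have hfin := HausdorffHardy.isFiniteMeasure_weightMeasure hφp
  have hν := HausdorffHardy.ae_weightMeasure_pos p.toReal φ
  -- The Hilbert transform is taken to be the scalar operator `-i`, so the commutation is linearity
  -- of the averaging operator.
  refine ⟨fun f => ?_, HausdorffHardy.dilationAverageCLM hν hp₁ hp₂, fun f => ?_, ?_,
    -Complex.I • ContinuousLinearMap.id ℂ _, fun f => ?_, ?_⟩
  · filter_upwards [HausdorffHardy.ae_integrable_dilation hν hp₁ hp₂
      (HausdorffHardy.measurable_coe_Lp f.1) (Lp.memLp f.1)] with x hx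
    exact (HausdorffHardy.integrable_dilation_weightMeasure_iff hφ₀ hφp _ x).1 hx
  · rw [← HausdorffHardy.dilationAverage_weightMeasure hφ₀ hφp]
    exact HausdorffHardy.coeFn_dilationAverageCLM hν hp₁ hp₂ f
  · rw [HausdorffHardy.norm_dilationAverageCLM hν hp₁ hp₂,
      HausdorffHardy.toReal_weightMeasure_univ hφ₀ hφp]
  · filter_upwards [HausdorffHardy.isHilbertTransform_neg_I_mul hp₁ hp₂ (Lp.memLp f.1)
      ((HausdorffHardy.mem_hardyPlus_iff hp₁ hp₂ f.1).1 f.2),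
      Lp.coeFn_smul (-Complex.I) f.1] with x h1 h2
    rw [Pi.smul_apply, smul_eq_mul] at h2
    rw [← h2] at h1
    exact h1
  · ext1 f
    simp
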